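/- A system is a finite register $A$ of $n$ qubits ($n\ge 0$), $d_A=2^{n}$, with computational basis $\{|x\rangle : x\in\{0,1\}^{A}\}$; $A'$ denotes a copy of $A$, and composites are unions of registers. \emph{Clifford unitaries} on a register are the products of Hadamard, phase and CNOT gates acting on its qubits. A \emph{stabilizer state} is a convex combination of states $U|0\cdots0\rangle\langle0\cdots0|U^\dagger$ with $U$ a Clifford unitary. Let $\Phi_{AA'}=\sum_{x,y}|x\rangle\langle y|_A\otimes|x\rangle\langle y|_{A'}$. The renormalized Choi matrix of a channel $\mathcal M_{A\to B}$ is $\mu_{B:A'}=\frac1{d_A}(\mathcal M_{A\to B}\otimes\mathcal I_{A'})(\Phi_{AA'})$; a bipartite state $\mu_{BA'}$ is of this form iff $\operatorname{tr}_B\mu_{BA'}=\frac1{d_A}\mathbb 1_{A'}$. The link product with a state $\rho_A$ is $\mu_{B:A'}*\rho_A=\operatorname{tr}_{A'A}[(\mu_{BA'}\otimes\rho_A)(\mathbb 1_B\otimes\Phi_{A'A})]$. A \emph{resource theory} is a class of \emph{free} channels between systems that contains identities, swaps (and renamings or reorderings of qubits) and discarding maps, and is closed under sequential and parallel composition; a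 state is free if its preparation (as a channel from the trivial system) is free. The \emph{Choi-defined operations} of a set $\mathfrak F$ of states are the channels whose renormalized Choi matrix lies in $\mathfrak F$. A resource theory is \emph{Choi-defined} (a CDRT) if its free operations are exactly the Choi-defined operations of its set of free states. A channel $\mathcal M_{A\to B}$ is \emph{completely stabilizer-preserving} if $(\mathcal M_{A\to B}\otimes\mathcal I_R)(\rho_{AR})$ is a stabilizer state for every system $R$ and every stabilizer state $\rho_{AR}$. \emph{Stabilizer operations} are the maps built, by sequential composition and probabilistic mixing, from qubit renamings, Clifford unitaries, preparation of $|0\rangle$, and computational-basis measurements of a qubit whose outcome may control the choice of the subsequent stabilizer operation. \textbf{Theorem.} \begin{enumerate} \item For every $A$, $\frac1{d_A}\Phi_{AA'}$ is a stabilizer state. \item For all $A,B$: if $\mu_{BA'}$ and $\rho_A$ are stabilizer states and $\operatorname{tr}_B\mu_{BA'}=\frac1{d_A}\mathbb 1_{A'}$, then $d_A\,\mu_{B:A'}*\rho_A$ is a stabilizer state. \item The state in (2) is obtained by a postselected Bell measurement. Let $|\beta_{z,x}\rangle=\bigotimes_{j}\frac{1}{\sqrt2}\left(|0,x_j\rangle+(-1)^{z_j}|1,1\oplus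 x_j\rangle\right)$ be the Bell basis of the qubit pairs of $A'A$. Then $|\beta_{0,0}\rangle\langle\beta_{0,0}|=\frac1{d_A}\Phi_{A'A}$, and there is a product $U$ of Hadamard and CNOT gates on $A'A$ with $U|\beta_{z,x}\rangle=|z\rangle|x\rangle$ for all $z,x$. For $\mu_{BA'}$ and $\rho_A$ as in (2), $\mu_{BA'}\otimes\rho_A$ is a stabilizer state, $\mathbb 1_B\otimes U$ is a Clifford unitary, and if this unitary is applied to $\mu_{BA'}\otimes\rho_A$ and $A'A$ is then measured in the computational basis, the outcome $0\cdots0$ has probability $d_A^{-2}$ and, postselected on it, the system $B$ is in the state $d_A\,\mu_{B:A'}*\rho_A$. \item Consequently, the Choi-defined operations of the set of stabilizer states form a CDRT, and its free states are exactly the stabilizer states. \item This CDRT is the resource theory of magic states: its free operations are exactly the completely stabilizer-preserving channels. It contains all stabilizer operations, and the states that can be prepared by stabilizer operations are exactly its free states. \end{enumerate} -/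

import Mathlib

noncomputable section

namespace MagicCDRT

open scoped Matrix ComplexOrder

/-! ### Qubit registers, operators and elementary tensor calculus

A system is a finite register of qubits, given by the finite type `A` of its qubit labels
(an `n`-qubit system is `A = Fin n`).  Its computational basis is indexed by bit strings
`A → Fin 2`.  The composite of `A` and `B` is the register `A ⊕ B`, and the trivial system is
the register `Empty`. -/

/-- Linear operators on the Hilbert space of the register `A`. -/
abbrev Op (A : Type) := Matrix (A → Fin 2) (A → Fin 2) ℂ

/-- The Hilbert space dimension `d_A = 2 ^ |A|`. -/
def dim (A : Type) [Fintype A] : ℂ := 2 ^ Fintype.card A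

/-- The tensor product `ρ_A ⊗ σ_B`. -/
def tensor {A B : Type} (ρ : Op A) (σ : Op B) : Op (A ⊕ B) :=
  Matrix.of fun x y =>
    ρ (fun a => x (Sum.inl a)) (fun a => y (Sum.inl a)) *
      σ (fun b => x (Sum.inr b)) (fun b => y (Sum.inr b))

/-- The partial trace over the right factor. -/
def ptraceRight {A B : Type} [Fintype B] [DecidableEq B] (M : Op (A ⊕ B)) : Op A :=
  Matrix.of fun x y => ∑ z : B → Fin 2, M (Sum.elim x z) (Sum.elim y z)

/-- The partial trace over the left factor. -/
def ptraceLeft {A B : Type} [Fintype A] [DecidableEq A] (M : Op (A ⊕ B)) : Op B :=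
  Matrix.of fun x y => ∑ z : A → Fin 2, M (Sum.elim z x) (Sum.elim z y)

/-- The linear map that renames (or permutes) the qubits of a register along a bijection. -/
def relabel {A B : Type} (e : A ≃ B) : Op A →ₗ[ℂ] Op B where
  toFun M := Matrix.of fun x y => M (fun a => x (e a)) (fun a => y (e a))
  map_add' _ _ := rfl
  map_smul' _ _ := rfl

/-- The tensor product (parallel composition) `E ⊗ F` of linear maps: the linear map that sends
`|a⟩⟨a'| ⊗ |c⟩⟨c'|` to `E (|a⟩⟨a'|) ⊗ F (|c⟩⟨c'|)`. -/
def tensorMap {A B C D : Type} [Fintype A] [DecidableEq A] [Fintype C] [DecidableEq C]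
    (E : Op A →ₗ[ℂ] Op B) (F : Op C →ₗ[ℂ] Op D) : Op (A ⊕ C) →ₗ[ℂ] Op (B ⊕ D) where
  toFun M := ∑ a : A → Fin 2, ∑ a' : A → Fin 2, ∑ c : C → Fin 2, ∑ c' : C → Fin 2,
    M (Sum.elim a c) (Sum.elim a' c') •
      tensor (E (Matrix.single a a' 1)) (F (Matrix.single c c' 1))
  map_add' M N := by simp [add_smul, Finset.sum_add_distrib]
  map_smul' r M := by simp [mul_smul, Finset.smul_sum]

/-- A quantum channel: a completely positive trace-preserving linear map.  Since every
finite-dimensional ancilla embeds in a register of qubits, ancillary registers `R` suffice. -/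
def IsChannel {A B : Type} [Fintype A] [DecidableEq A] [Fintype B] [DecidableEq B]
    (E : Op A →ₗ[ℂ] Op B) : Prop :=
  (∀ (R : Type) [Fintype R] [DecidableEq R] (M : Op (A ⊕ R)), M.PosSemidef →
    (tensorMap E (LinearMap.id : Op R →ₗ[ℂ] Op R) M).PosSemidef) ∧
  ∀ M : Op A, (E M).trace = M.trace

/-- The discarding channel, from `A` to the trivial system. -/
def discard (A : Type) [Fintype A] [DecidableEq A] : Op A →ₗ[ℂ] Op Empty where
  toFun M := Matrix.of fun _ _ => M.trace
  map_add' M N := by ext; simp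
  map_smul' r M := by ext; simp

/-- The map from the trivial system to `A` that prepares `ρ`. -/
def prepareMap {A : Type} (ρ : Op A) : Op Empty →ₗ[ℂ] Op A where
  toFun M := M.trace • ρ
  map_add' M N := by simp [add_smul]
  map_smul' r M := by simp [mul_smul]

/-! ### Choi matrices and the link product -/

/-- The unnormalized Choi state `Φ_{AA'} = ∑_{x,y} |x⟩⟨y|_A ⊗ |x⟩⟨y|_{A'}`. -/
def choiState (A : Type) [Fintype A] [DecidableEq A] : Op (A ⊕ A) :=
  ∑ x : A → Fin 2, ∑ y : A → Fin 2, tensor (Matrix.single x y 1) (Matrix.single x y 1)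

/-- The Choi matrix `M_{B:A'} = (E ⊗ id_{A'}) (Φ_{AA'})`. -/
def choi {A B : Type} [Fintype A] [DecidableEq A] (E : Op A →ₗ[ℂ] Op B) : Op (B ⊕ A) :=
  tensorMap E (LinearMap.id : Op A →ₗ[ℂ] Op A) (choiState A)

/-- The renormalized Choi matrix. -/
def renormChoi {A B : Type} [Fintype A] [DecidableEq A] (E : Op A →ₗ[ℂ] Op B) : Op (B ⊕ A) :=
  (dim A)⁻¹ • choi E

/-- The operator `μ_{BA'} ⊗ ρ_A`, viewed on the register `B ⊕ (A' ⊕ A)`. -/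
def pairOp {A B : Type} (μ : Op (B ⊕ A)) (ρ : Op A) : Op (B ⊕ (A ⊕ A)) :=
  relabel (Equiv.sumAssoc B A A) (tensor μ ρ)

/-- The link product `μ_{B:A'} * ρ_A = tr_{A'A} [(μ_{BA'} ⊗ ρ_A) (1_B ⊗ Φ_{A'A})]`. -/
def link {A B : Type} [Fintype A] [DecidableEq A] [Fintype B] [DecidableEq B]
    (μ : Op (B ⊕ A)) (ρ : Op A) : Op B :=
  ptraceRight (pairOp μ ρ * tensor (1 : Op B) (choiState A))

/-! ### Choi-defined resource theories -/

/-- A class of linear maps between operator spaces of qubit registers. -/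
abbrev MapClass := ∀ (A B : Type) [Fintype A] [DecidableEq A] [Fintype B] [DecidableEq B],
  (Op A →ₗ[ℂ] Op B) → Prop

/-- A class of operators on qubit registers. -/
abbrev OpClass := ∀ (A : Type) [Fintype A] [DecidableEq A], Op A → Prop

/-- A quantum resource theory on qubit systems, given by its class of free operations: they are
channels; identity, swap and discarding are free; sequential and parallel composites of free
channels are free.  The clause `relabel_free` says that the names and the order of the qubits of
a register are immaterial (it includes the identifications `(A ⊕ B) ⊕ C ≃ A ⊕ (B ⊕ C)` and
`Empty ⊕ A ≃ A`). -/
structure IsResourceTheory (F : MapClass) : Prop where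
  channel : ∀ (A B : Type) [Fintype A] [DecidableEq A] [Fintype B] [DecidableEq B]
    (E : Op A →ₗ[ℂ] Op B), F A B E → IsChannel E
  id_free : ∀ (A : Type) [Fintype A] [DecidableEq A], F A A LinearMap.id
  swap_free : ∀ (A B : Type) [Fintype A] [DecidableEq A] [Fintype B] [DecidableEq B],
    F (A ⊕ B) (B ⊕ A) (relabel (Equiv.sumComm A B))
  relabel_free : ∀ (A B : Type) [Fintype A] [DecidableEq A] [Fintype B] [DecidableEq B]
    (e : A ≃ B), F A B (relabel e)
  discard_free : ∀ (A : Type) [Fintype A] [DecidableEq A], F A Empty (discard A)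
  comp_free : ∀ (A B C : Type) [Fintype A] [DecidableEq A] [Fintype B] [DecidableEq B]
    [Fintype C] [DecidableEq C] (E : Op A →ₗ[ℂ] Op B) (G : Op B →ₗ[ℂ] Op C),
    F A B E → F B C G → F A C (G ∘ₗ E)
  tensor_free : ∀ (A B C D : Type) [Fintype A] [DecidableEq A] [Fintype B] [DecidableEq B]
    [Fintype C] [DecidableEq C] [Fintype D] [DecidableEq D]
    (E : Op A →ₗ[ℂ] Op B) (G : Op C →ₗ[ℂ] Op D),
    F A B E → F C D G → F (A ⊕ C) (B ⊕ D) (tensorMap E G)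

/-- The free states of a resource theory: those whose preparation is a free operation. -/
def freeStates (F : MapClass) : OpClass := fun A _ _ ρ => F Empty A (prepareMap ρ)

/-- The Choi-defined operations associated with a class of states: the channels whose
renormalized Choi matrix belongs to the class. -/
def CDOps (S : OpClass) : MapClass := fun A B _ _ _ _ E =>
  IsChannel E ∧ S (B ⊕ A) (renormChoi E)

/-- A Choi-defined resource theory: a resource theory whose free operations coincide with the
Choi-defined operations associated with its free states. -/
def IsCDRT (F : MapClass) : Prop :=
  IsResourceTheory F ∧
  ∀ (A B : Type) [Fintype A] [DecidableEq A] [Fintype B] [DecidableEq B]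
    (E : Op A →ₗ[ℂ] Op B), F A B E ↔ CDOps (freeStates F) A B E

/-- The completely resource-non-generating operations associated with a class of states. -/
def CRNGOps (S : OpClass) : MapClass := fun A B _ _ _ _ E =>
  IsChannel E ∧ ∀ (R : Type) [Fintype R] [DecidableEq R] (ρ : Op (A ⊕ R)),
    S (A ⊕ R) ρ → S (B ⊕ R) (tensorMap E (LinearMap.id : Op R →ₗ[ℂ] Op R) ρ)

/-! ### Clifford circuits, stabilizer states and stabilizer operations -/

/-- The Hadamard gate on qubit `j`. -/
def hadamardGate {A : Type} [Fintype A] [DecidableEq A] (j : A) : Op A :=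
  Matrix.of fun x y =>
    if ∀ k, k ≠ j → x k = y k then
      (-1 : ℂ) ^ ((x j : ℕ) * (y j : ℕ)) / ((Real.sqrt 2 : ℝ) : ℂ)
    else 0

/-- The phase gate `diag(1, i)` on qubit `j`. -/
def phaseGate {A : Type} [Fintype A] [DecidableEq A] (j : A) : Op A :=
  Matrix.diagonal fun x => Complex.I ^ (x j : ℕ)

/-- The CNOT gate with control qubit `c` and target qubit `t`, sending `|y⟩` to the basis vector
whose bit `t` is `y t + y c` modulo 2. -/
def cnotGate {A : Type} [Fintype A] [DecidableEq A] (c t : A) : Op A :=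
  Matrix.of fun x y => if x = Function.update y t (y t + y c) then 1 else 0

/-- Unitaries implemented by circuits of Hadamard and CNOT gates. -/
def hadamardCnotCircuits (A : Type) [Fintype A] [DecidableEq A] : Submonoid (Op A) :=
  Submonoid.closure
    ({U | ∃ j : A, U = hadamardGate j} ∪ {U | ∃ c t : A, c ≠ t ∧ U = cnotGate c t})

/-- Clifford unitaries: those implemented by circuits of Hadamard, phase and CNOT gates. -/
def cliffordCircuits (A : Type) [Fintype A] [DecidableEq A] : Submonoid (Op A) :=
  Submonoid.closure
    ({U | ∃ j : A, U = hadamardGate j} ∪ {U | ∃ j : A, U = phaseGate j} ∪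
      {U | ∃ c t : A, c ≠ t ∧ U = cnotGate c t})

/-- The projector `|0…0⟩⟨0…0|`. -/
def zeroState (A : Type) [DecidableEq (A → Fin 2)] : Op A := Matrix.single 0 0 1

/-- Stabilizer states: convex mixtures of the pure states `U |0…0⟩` with `U` Clifford. -/
def IsStabilizerState : OpClass := fun A _ _ ρ =>
  ρ ∈ convexHull ℝ {σ : Op A | ∃ U ∈ cliffordCircuits A, σ = U * zeroState A * Uᴴ}

/-- The map `M ↦ U M U†`. -/
def conjMap {A : Type} [Fintype A] [DecidableEq A] (U : Op A) : Op A →ₗ[ℂ] Op A :=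
  LinearMap.mulRight ℂ Uᴴ ∘ₗ LinearMap.mulLeft ℂ U

/-- Preparation of a fresh qubit in the state `|0⟩`. -/
def attachZero (A : Type) : Op A →ₗ[ℂ] Op (Unit ⊕ A) where
  toFun M := tensor (zeroState Unit) M
  map_add' M N := by ext; simp [tensor, mul_add]
  map_smul' r M := by ext; simp [tensor, mul_left_comm]

/-- The (subnormalized) branch `M ↦ ⟨b| M |b⟩` of a computational-basis measurement of the first
qubit with outcome `b`. -/
def branch (A : Type) (b : Fin 2) : Op (Unit ⊕ A) →ₗ[ℂ] Op A where
  toFun M := Matrix.of fun x y => M (Sum.elim (fun _ => b) x) (Sum.elim (fun _ => b) y)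
  map_add' _ _ := rfl
  map_smul' _ _ := rfl

/-- Stabilizer operations: the maps built by sequential composition from Clifford unitaries,
preparation of `|0⟩`, and computational-basis measurements whose outcome may control the rest of
the protocol, with classical randomness. Measuring and ignoring the outcome discards a qubit. -/
inductive IsStabilizerOp : ∀ {A B : Type}, (Op A →ₗ[ℂ] Op B) → Prop
  | relabel {A B : Type} [Fintype A] [DecidableEq A] [Fintype B] [DecidableEq B] (e : A ≃ B) :
      IsStabilizerOp (relabel e)
  | clifford {A : Type} [Fintype A] [DecidableEq A] (U : Op A) (hU : U ∈ cliffordCircuits A) :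
      IsStabilizerOp (conjMap U)
  | prepare (A : Type) [Fintype A] [DecidableEq A] : IsStabilizerOp (attachZero A)
  | measure {A B : Type} [Fintype A] [DecidableEq A] [Fintype B] [DecidableEq B]
      (E : Fin 2 → (Op A →ₗ[ℂ] Op B)) (hE : ∀ b, IsStabilizerOp (E b)) :
      IsStabilizerOp (∑ b : Fin 2, E b ∘ₗ branch A b)
  | comp {A B C : Type} [Fintype A] [DecidableEq A] [Fintype B] [DecidableEq B]
      [Fintype C] [DecidableEq C] (E : Op A →ₗ[ℂ] Op B) (F : Op B →ₗ[ℂ] Op C)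
      (hE : IsStabilizerOp E) (hF : IsStabilizerOp F) : IsStabilizerOp (F ∘ₗ E)
  | mix {A B : Type} [Fintype A] [DecidableEq A] [Fintype B] [DecidableEq B] (p : ℝ)
      (hp0 : 0 ≤ p) (hp1 : p ≤ 1) (E F : Op A →ₗ[ℂ] Op B)
      (hE : IsStabilizerOp E) (hF : IsStabilizerOp F) :
      IsStabilizerOp ((p : ℂ) • E + ((1 - p : ℝ) : ℂ) • F)

/-! ### Bell measurement and postselection -/

/-- The Bell basis of the pairs `(j', j)` of qubits of `A' ⊕ A`: the vector with outcome
`s = (z, x)` is `⊗_j (|0, x_j⟩ + (-1)^{z_j} |1, 1 + x_j⟩) / √2`. -/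
def bellVector {A : Type} [Fintype A] [DecidableEq A] (s : A ⊕ A → Fin 2) :
    (A ⊕ A → Fin 2) → ℂ := fun p =>
  ∏ j : A, if p (Sum.inr j) = p (Sum.inl j) + s (Sum.inr j) then
      (-1 : ℂ) ^ ((s (Sum.inl j) : ℕ) * (p (Sum.inl j) : ℕ)) / ((Real.sqrt 2 : ℝ) : ℂ)
    else 0

/-- The projector `1_B ⊗ |s⟩⟨s|_R` of the computational-basis measurement of the register `R`. -/
def outcomeProj (B : Type) {R : Type} [Fintype R] [DecidableEq R] [Fintype B] [DecidableEq B]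
    (s : R → Fin 2) : Op (B ⊕ R) := tensor (1 : Op B) (Matrix.single s s 1)

/-- The probability of the outcome `s` when `R` is measured in the computational basis. -/
def outcomeProb {B R : Type} [Fintype R] [DecidableEq R] [Fintype B] [DecidableEq B]
    (ω : Op (B ⊕ R)) (s : R → Fin 2) : ℂ := (outcomeProj B s * ω).trace

/-- The state of `B` after `R` is measured in the computational basis and the outcome `s` is
postselected. -/
def postselect {B R : Type} [Fintype R] [DecidableEq R] [Fintype B] [DecidableEq B]
    (ω : Op (B ⊕ R)) (s : R → Fin 2) : Op B :=
  (outcomeProb ω s)⁻¹ • ptraceRight (outcomeProj B s * ω * outcomeProj B s)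

end MagicCDRT

end

open MagicCDRT
open scoped Matrix

open MagicCDRT
open scoped Matrix

/-! The heart of the matter is that stabilizer vectors, taken up to arbitrary complex scalars (zero
included), are closed under contracting a register shared by two of them. Contraction is a
projection onto a Bell vector, so a Clifford circuit that rotates the Bell basis to the
computational basis (`exists_bell_circuit`) reduces it to taking a slice `⟨s|ψ⟩` at a computational
basis state.

Slices (`slice_mem_stabVec`) are handled by Pauli operators. Cliffords normalize the Pauli group, so
`ψ + Pψ` is a stabilizer vector whenever `ψ` is and `P` is Pauli (`one_add_pauli_mem_stabVec`):
pulled back through the circuit of `ψ`, it is `|0⟩ + i^k|x⟩`, which is easily prepared. Hence the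
Pauli projections behind a computational measurement preserve stabilizer vectors. They show that `φ
⊗ |s⟩` is one; the Pauli stabilizers of that vector restrict to Paulis on the smaller register, and
the product of the resulting projections builds `φ` there from a basis state.

Mixtures are treated in the convex cone spanned by the operators `|ψ⟩⟨ψ|`; stabilizer states are its
elements of trace one (`isStabilizerState_iff`), so probabilities and normalizations reduce to
traces. Since `(E ⊗ id) ρ` is the contraction of the Choi matrix of `E` with `ρ`, a stabilizer Choi
matrix makes `E` completely stabilizer-preserving; the converse applies `E` to half of the maximally
entangled stabilizer state (`cdOps_iff_crngOps`). Complete preservation is plainly stable under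
sequential and parallel composition, which gives the resource theory.

Stabilizer operations are treated by one induction over all operator classes with suitable closure
properties (`StabilizerClosed`). The positive semidefinite operators give complete positivity, the
stabilizer cone gives stabilizer preservation. -/

namespace MagicCDRT

open scoped ComplexOrder NNReal

/-! ### Action of the gates on vectors -/

section Gates

variable {A : Type} [Fintype A] [DecidableEq A]

/-- State vectors of the register `A`. -/
abbrev Vec (A : Type) := (A → Fin 2) → ℂ

-- Shows that each row of a Hadamard gate has just two nonzero entries.
omit [Fintype A] in
theorem agree_off_iff (j : A) (x y : A → Fin 2) :
    (∀ k, k ≠ j → x k = y k) ↔ ∃ b, y = Function.update x j b := by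
  constructor
  · intro h
    refine ⟨y j, funext fun k => ?_⟩
    by_cases hk : k = j
    · subst hk; simp
    · simp [hk, h k hk]
  · rintro ⟨b, rfl⟩ k hk
    simp [hk]

theorem hadamardGate_mulVec (j : A) (ψ : Vec A) (x : A → Fin 2) :
    (hadamardGate j *ᵥ ψ) x =
      (ψ (Function.update x j 0) + (-1) ^ (x j : ℕ) * ψ (Function.update x j 1)) /
        ((Real.sqrt 2 : ℝ) : ℂ) := by
  have hne : Function.update x j 0 ≠ Function.update x j 1 := fun h => by
    simpa using congrFun h j
  have h : ∀ y, hadamardGate j x y * ψ y =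
      (if y = Function.update x j 0 then ψ y / ((Real.sqrt 2 : ℝ) : ℂ) else 0) +
      (if y = Function.update x j 1 then
        (-1) ^ (x j : ℕ) * ψ y / ((Real.sqrt 2 : ℝ) : ℂ) else 0) := by
    intro y
    simp only [hadamardGate, Matrix.of_apply, agree_off_iff]
    by_cases h0 : y = Function.update x j 0
    · have h1 : y ≠ Function.update x j 1 := h0 ▸ hne
      rw [if_pos ⟨0, h0⟩, if_pos h0, if_neg h1]
      subst h0
      simp; ring
    · by_cases h1 : y = Function.update x j 1
      · rw [if_pos ⟨1, h1⟩, if_neg h0, if_pos h1]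
        subst h1
        simp; ring
      · rw [if_neg, if_neg h0, if_neg h1]
        · simp
        · rintro ⟨b, hb⟩
          fin_cases b
          · exact h0 hb
          · exact h1 hb
  simp only [Matrix.mulVec, dotProduct, h, Finset.sum_add_distrib, Finset.sum_ite_eq',
    Finset.mem_univ, if_true]
  ring

theorem phaseGate_mulVec (j : A) (ψ : Vec A) (x : A → Fin 2) :
    (phaseGate j *ᵥ ψ) x = Complex.I ^ (x j : ℕ) * ψ x := by
  simp [phaseGate, Matrix.mulVec_diagonal]

theorem fin_two_add_self (a b : Fin 2) : a + b + b = a := by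
  fin_cases a <;> fin_cases b <;> rfl

omit [Fintype A] in
theorem cnot_involutive {c t : A} (h : c ≠ t) (x : A → Fin 2) :
    Function.update (Function.update x t (x t + x c)) t
      (Function.update x t (x t + x c) t + Function.update x t (x t + x c) c) = x := by
  simp [h, fin_two_add_self]

omit [Fintype A] in
theorem eq_cnot_iff {c t : A} (h : c ≠ t) (x y : A → Fin 2) :
    x = Function.update y t (y t + y c) ↔ y = Function.update x t (x t + x c) := by
  constructor <;> (intro e; rw [e]; exact (cnot_involutive h _).symm)

theorem cnotGate_mulVec {c t : A} (h : c ≠ t) (ψ : Vec A) (x : A → Fin 2) :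
    (cnotGate c t *ᵥ ψ) x = ψ (Function.update x t (x t + x c)) := by
  simp only [cnotGate, Matrix.mulVec, dotProduct, Matrix.of_apply, ite_mul, one_mul, zero_mul]
  rw [Finset.sum_congr rfl fun y _ => if_congr (eq_cnot_iff h x y) rfl rfl]
  simp

theorem hadamardGate_mem (j : A) : hadamardGate j ∈ cliffordCircuits A :=
  Submonoid.subset_closure (Or.inl (Or.inl ⟨j, rfl⟩))

theorem phaseGate_mem (j : A) : phaseGate j ∈ cliffordCircuits A :=
  Submonoid.subset_closure (Or.inl (Or.inr ⟨j, rfl⟩))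

theorem cnotGate_mem {c t : A} (h : c ≠ t) : cnotGate c t ∈ cliffordCircuits A :=
  Submonoid.subset_closure (Or.inr ⟨c, t, h, rfl⟩)

theorem hadamardCnotCircuits_le : hadamardCnotCircuits A ≤ cliffordCircuits A :=
  Submonoid.closure_mono fun _ h => h.elim (fun h => Or.inl (Or.inl h)) Or.inr

theorem cliffordCircuits_induction {p : Op A → Prop} (one : p 1)
    (mul : ∀ U V, p U → p V → p (U * V)) (had : ∀ j, p (hadamardGate j))
    (pha : ∀ j, p (phaseGate j)) (cnot : ∀ c t, c ≠ t → p (cnotGate c t))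
    {U : Op A} (hU : U ∈ cliffordCircuits A) : p U := by
  induction hU using Submonoid.closure_induction with
  | mem U h =>
    rcases h with (⟨j, rfl⟩ | ⟨j, rfl⟩) | ⟨c, t, h, rfl⟩
    exacts [had j, pha j, cnot c t h]
  | one => exact one
  | mul U V _ _ hU hV => exact mul U V hU hV

theorem hadamardGate_conjTranspose (j : A) : (hadamardGate j)ᴴ = hadamardGate j := by
  ext x y
  simp only [hadamardGate, Matrix.conjTranspose_apply, Matrix.of_apply]
  have : (∀ k, k ≠ j → y k = x k) ↔ (∀ k, k ≠ j → x k = y k) :=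
    forall₂_congr fun _ _ => eq_comm
  simp only [this]
  split_ifs
  · simp [mul_comm, Complex.conj_ofReal]
  · simp

theorem fin_two_cases (b : Fin 2) : b = 0 ∨ b = 1 := by fin_cases b <;> simp

theorem sqrt_two_sq : ((Real.sqrt 2 : ℝ) : ℂ) * ((Real.sqrt 2 : ℝ) : ℂ) = 2 := by
  norm_cast; simp

theorem sqrt_two_ne : ((Real.sqrt 2 : ℝ) : ℂ) ≠ 0 := by
  norm_cast; simp

theorem hadamardGate_mul_self (j : A) : hadamardGate j * hadamardGate j = 1 := by
  refine Matrix.ext_of_mulVec_single fun y => ?_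
  rw [← Matrix.mulVec_mulVec, Matrix.one_mulVec]
  generalize (Pi.single y 1 : Vec A) = ψ
  ext x
  simp only [hadamardGate_mulVec, Function.update_self, Function.update_idem]
  have hs := sqrt_two_sq
  have hn := sqrt_two_ne
  have hx := Function.update_eq_self j x
  rcases fin_two_cases (x j) with h | h <;> rw [h] at hx ⊢ <;> simp [hx] <;> field_simp <;>
    rw [pow_two, hs] <;> ring

theorem cnotGate_conjTranspose {c t : A} (h : c ≠ t) : (cnotGate c t)ᴴ = cnotGate c t := by
  ext x y
  simp [cnotGate, Matrix.conjTranspose_apply, eq_cnot_iff h y x]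

theorem cnotGate_mul_self {c t : A} (h : c ≠ t) : cnotGate c t * cnotGate c t = 1 := by
  refine Matrix.ext_of_mulVec_single fun y => ?_
  rw [← Matrix.mulVec_mulVec, Matrix.one_mulVec]
  ext x
  rw [cnotGate_mulVec h, cnotGate_mulVec h, cnot_involutive h]

theorem phaseGate_conjTranspose (j : A) :
    (phaseGate j)ᴴ = phaseGate j * phaseGate j * phaseGate j := by
  simp only [phaseGate, Matrix.diagonal_conjTranspose, Matrix.diagonal_mul_diagonal]
  congr 1
  ext x
  rcases fin_two_cases (x j) with h | h <;> simp [h]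

theorem phaseGate_conjTranspose_mul (j : A) : (phaseGate j)ᴴ * phaseGate j = 1 := by
  simp only [phaseGate, Matrix.diagonal_conjTranspose, Matrix.diagonal_mul_diagonal]
  rw [← Matrix.diagonal_one]
  congr 1
  ext x
  rcases fin_two_cases (x j) with h | h <;> simp [h]

/-- Hadamard and CNOT are self-adjoint and the phase gate satisfies `S† = S³`, so the monoid of
circuits is in fact a group. -/
theorem conjTranspose_mem_cliffordCircuits {U : Op A} (hU : U ∈ cliffordCircuits A) :
    Uᴴ ∈ cliffordCircuits A := by
  refine cliffordCircuits_induction (p := fun U => Uᴴ ∈ cliffordCircuits A)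
    ?_ ?_ ?_ ?_ ?_ hU
  · simp [one_mem]
  · intro U V hU hV
    rw [Matrix.conjTranspose_mul]
    exact mul_mem hV hU
  · intro j
    rw [hadamardGate_conjTranspose]
    exact hadamardGate_mem j
  · intro j
    rw [phaseGate_conjTranspose]
    exact mul_mem (mul_mem (phaseGate_mem j) (phaseGate_mem j)) (phaseGate_mem j)
  · intro c t h
    rw [cnotGate_conjTranspose h]
    exact cnotGate_mem h

theorem conjTranspose_mul_self_of_clifford {U : Op A} (hU : U ∈ cliffordCircuits A) :
    Uᴴ * U = 1 := by
  refine cliffordCircuits_induction (p := fun U => Uᴴ * U = 1) ?_ ?_ ?_ ?_ ?_ hU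
  · simp
  · intro U V hU hV
    rw [Matrix.conjTranspose_mul, Matrix.mul_assoc, ← Matrix.mul_assoc _ U, hU, Matrix.one_mul, hV]
  · intro j
    rw [hadamardGate_conjTranspose, hadamardGate_mul_self]
  · exact phaseGate_conjTranspose_mul
  · intro c t h
    rw [cnotGate_conjTranspose h, cnotGate_mul_self h]

theorem mul_conjTranspose_self_of_clifford {U : Op A} (hU : U ∈ cliffordCircuits A) :
    U * Uᴴ = 1 :=
  mul_eq_one_comm.mp (conjTranspose_mul_self_of_clifford hU)

end Gates

/-! ### Pauli operators -/

section Pauli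

variable {A : Type} [DecidableEq A]

/-- The bit flip on qubit `j`. -/
def bitFlip (j : A) : Module.End ℂ (Vec A) :=
  LinearMap.funLeft ℂ ℂ fun x => Function.update x j (x j + 1)

/-- The phase flip on qubit `j`. -/
def phaseFlip (j : A) : Module.End ℂ (Vec A) where
  toFun ψ x := (-1) ^ (x j : ℕ) * ψ x
  map_add' ψ φ := by ext; simp [mul_add]
  map_smul' r ψ := by ext; simp [mul_left_comm]

theorem bitFlip_apply (j : A) (ψ : Vec A) (x : A → Fin 2) :
    bitFlip j ψ x = ψ (Function.update x j (x j + 1)) := rfl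

omit [DecidableEq A] in
theorem phaseFlip_apply (j : A) (ψ : Vec A) (x : A → Fin 2) :
    phaseFlip j ψ x = (-1) ^ (x j : ℕ) * ψ x := rfl

/-- The Pauli group, generated by `i`, the bit flips and the phase flips. -/
def pauliGroup (A : Type) [DecidableEq A] : Submonoid (Module.End ℂ (Vec A)) :=
  Submonoid.closure ({Complex.I • 1} ∪ {P | ∃ j, P = bitFlip j} ∪ {P | ∃ j, P = phaseFlip j})

theorem bitFlip_mem (j : A) : bitFlip j ∈ pauliGroup A :=
  Submonoid.subset_closure (Or.inl (Or.inr ⟨j, rfl⟩))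

theorem phaseFlip_mem (j : A) : phaseFlip j ∈ pauliGroup A :=
  Submonoid.subset_closure (Or.inr ⟨j, rfl⟩)

theorem pauliGroup_induction {p : Module.End ℂ (Vec A) → Prop} (one : p 1)
    (mul : ∀ P Q, p P → p Q → p (P * Q)) (phase : p (Complex.I • 1))
    (X : ∀ j, p (bitFlip j)) (Z : ∀ j, p (phaseFlip j))
    {P : Module.End ℂ (Vec A)} (hP : P ∈ pauliGroup A) : p P := by
  induction hP using Submonoid.closure_induction with
  | mem P h =>
    rcases h with (rfl | ⟨j, rfl⟩) | ⟨j, rfl⟩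
    exacts [phase, X j, Z j]
  | one => exact one
  | mul P Q _ _ hP hQ => exact mul P Q hP hQ

theorem I_pow_smul_mem (k : ℕ) {P : Module.End ℂ (Vec A)} (hP : P ∈ pauliGroup A) :
    Complex.I ^ k • P ∈ pauliGroup A := by
  have h : (Complex.I • 1 : Module.End ℂ (Vec A)) ∈ pauliGroup A :=
    Submonoid.subset_closure (Or.inl (Or.inl rfl))
  have : Complex.I ^ k • P = (Complex.I • 1) ^ k * P := by
    rw [smul_pow, one_pow, smul_mul_assoc, one_mul]
  rw [this]
  exact mul_mem (pow_mem h k) hP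

theorem neg_one_pow_smul_mem (k : ℕ) {P : Module.End ℂ (Vec A)} (hP : P ∈ pauliGroup A) :
    (-1 : ℂ) ^ k • P ∈ pauliGroup A := by
  rw [← Complex.I_sq, ← pow_mul]
  exact I_pow_smul_mem _ hP

end Pauli

/-! ### Conjugation of Pauli operators by Clifford circuits -/

section PauliConj

variable {A : Type} [Fintype A] [DecidableEq A]

theorem neg_one_pow_fin_two_add (a b : Fin 2) :
    (-1 : ℂ) ^ ((a + b : Fin 2) : ℕ) = (-1) ^ (a : ℕ) * (-1) ^ (b : ℕ) := by
  fin_cases a <;> fin_cases b <;> simp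

theorem fin_two_one_add_one : (1 + 1 : Fin 2) = 0 := rfl

/-- Conjugation by the Hadamard gate exchanges `X` and `Z` on its qubit and fixes them on all
others. -/
theorem pauli_comp_hadamardGate {P : Module.End ℂ (Vec A)} (j : A)
    (hP : (∃ k, P = bitFlip k) ∨ ∃ k, P = phaseFlip k) :
    ∃ Q ∈ pauliGroup A, ∀ ψ, P (hadamardGate j *ᵥ ψ) = hadamardGate j *ᵥ Q ψ := by
  rcases hP with ⟨k, rfl⟩ | ⟨k, rfl⟩ <;> by_cases hk : k = j
  · subst hk
    refine ⟨phaseFlip k, phaseFlip_mem k, fun ψ => funext fun x => ?_⟩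
    simp only [bitFlip_apply, phaseFlip_apply, hadamardGate_mulVec, Function.update_self,
      Function.update_idem, neg_one_pow_fin_two_add]
    simp
  · refine ⟨bitFlip k, bitFlip_mem k, fun ψ => funext fun x => ?_⟩
    simp only [bitFlip_apply, hadamardGate_mulVec, Function.update_of_ne hk,
      Function.update_of_ne (Ne.symm hk), Function.update_comm hk]
  · subst hk
    refine ⟨bitFlip k, bitFlip_mem k, fun ψ => funext fun x => ?_⟩
    simp only [bitFlip_apply, phaseFlip_apply, hadamardGate_mulVec, Function.update_self,
      Function.update_idem]
    rcases fin_two_cases (x k) with h | h <;> simp [h, fin_two_one_add_one] <;> ring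
  · refine ⟨phaseFlip k, phaseFlip_mem k, fun ψ => funext fun x => ?_⟩
    simp only [phaseFlip_apply, hadamardGate_mulVec, Function.update_of_ne hk]
    ring

theorem pauli_comp_phaseGate {P : Module.End ℂ (Vec A)} (j : A)
    (hP : (∃ k, P = bitFlip k) ∨ ∃ k, P = phaseFlip k) :
    ∃ Q ∈ pauliGroup A, ∀ ψ, P (phaseGate j *ᵥ ψ) = phaseGate j *ᵥ Q ψ := by
  rcases hP with ⟨k, rfl⟩ | ⟨k, rfl⟩
  · by_cases hk : k = j
    · subst hk
      -- `S† X S = -i X Z`, with `-i` written as `i³` to stay among powers of `i`.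
      refine ⟨Complex.I ^ 3 • (bitFlip k * phaseFlip k),
        I_pow_smul_mem _ (mul_mem (bitFlip_mem k) (phaseFlip_mem k)),
        fun ψ => funext fun x => ?_⟩
      simp only [bitFlip_apply, phaseFlip_apply, phaseGate_mulVec, Function.update_self,
        LinearMap.smul_apply, Module.End.mul_apply, Pi.smul_apply, smul_eq_mul]
      rcases fin_two_cases (x k) with h | h <;> simp [h, fin_two_one_add_one, ← mul_assoc]
    · refine ⟨bitFlip k, bitFlip_mem k, fun ψ => funext fun x => ?_⟩
      simp only [bitFlip_apply, phaseGate_mulVec, Function.update_of_ne (Ne.symm hk)]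
  · refine ⟨phaseFlip k, phaseFlip_mem k, fun ψ => funext fun x => ?_⟩
    simp only [phaseFlip_apply, phaseGate_mulVec]
    ring

/-- Under a CNOT, `X` spreads from control to target and `Z` from target to control; the other
generators are fixed. -/
theorem pauli_comp_cnotGate {P : Module.End ℂ (Vec A)} {c t : A} (hct : c ≠ t)
    (hP : (∃ k, P = bitFlip k) ∨ ∃ k, P = phaseFlip k) :
    ∃ Q ∈ pauliGroup A, ∀ ψ, P (cnotGate c t *ᵥ ψ) = cnotGate c t *ᵥ Q ψ := by
  rcases hP with ⟨k, rfl⟩ | ⟨k, rfl⟩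
  · by_cases hc : k = c
    · subst hc
      refine ⟨bitFlip k * bitFlip t, mul_mem (bitFlip_mem k) (bitFlip_mem t),
        fun ψ => funext fun x => ?_⟩
      simp only [bitFlip_apply, cnotGate_mulVec hct, Module.End.mul_apply]
      congr 1
      ext l : 1
      by_cases hl : l = t
      · subst hl; simp [hct, hct.symm, add_assoc]
      · by_cases hl' : l = k
        · subst hl'; simp [hl]
        · simp [hl, hl']
    · refine ⟨bitFlip k, bitFlip_mem k, fun ψ => funext fun x => ?_⟩
      simp only [bitFlip_apply, cnotGate_mulVec hct]
      congr 1
      ext l : 1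
      by_cases hl : l = t
      · subst hl
        by_cases hk : l = k
        · subst hk; simp [hct, add_right_comm]
        · simp [hk, Ne.symm hc]
      · by_cases hl' : l = k
        · subst hl'; simp [hl]
        · simp [hl, hl']
  · by_cases hk : k = t
    · subst hk
      refine ⟨phaseFlip k * phaseFlip c, mul_mem (phaseFlip_mem k) (phaseFlip_mem c),
        fun ψ => funext fun x => ?_⟩
      simp only [phaseFlip_apply, cnotGate_mulVec hct, Module.End.mul_apply,
        Function.update_self, neg_one_pow_fin_two_add, Function.update_of_ne hct]
      rw [← mul_assoc, mul_assoc ((-1) ^ (x k : ℕ)), ← mul_pow]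
      simp
    · refine ⟨phaseFlip k, phaseFlip_mem k, fun ψ => funext fun x => ?_⟩
      simp only [phaseFlip_apply, cnotGate_mulVec hct, Function.update_of_ne hk]

/-- Clifford unitaries normalize the Pauli group. -/
theorem pauli_comp_clifford {U : Op A} (hU : U ∈ cliffordCircuits A)
    {P : Module.End ℂ (Vec A)} (hP : P ∈ pauliGroup A) :
    ∃ Q ∈ pauliGroup A, ∀ ψ, P (U *ᵥ ψ) = U *ᵥ Q ψ := by
  -- The relation `P g = g Q` is multiplicative in `P`, and the scalar `i` commutes with everything,
  -- so each gate need only be tested on `X` and `Z`.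
  have gate : ∀ g : Op A, (∀ P, ((∃ k, P = bitFlip k) ∨ ∃ k, P = phaseFlip k) →
      ∃ Q ∈ pauliGroup A, ∀ ψ, P (g *ᵥ ψ) = g *ᵥ Q ψ) → ∀ P ∈ pauliGroup A,
      ∃ Q ∈ pauliGroup A, ∀ ψ, P (g *ᵥ ψ) = g *ᵥ Q ψ := by
    intro g h P hP
    refine pauliGroup_induction (p := fun P => ∃ Q ∈ pauliGroup A, ∀ ψ,
      P (g *ᵥ ψ) = g *ᵥ Q ψ) ?_ ?_ ?_ ?_ ?_ hP
    · exact ⟨1, one_mem _, fun ψ => rfl⟩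
    · rintro P₁ P₂ ⟨Q₁, h₁, e₁⟩ ⟨Q₂, h₂, e₂⟩
      exact ⟨Q₁ * Q₂, mul_mem h₁ h₂, fun ψ => by simp [e₁, e₂]⟩
    · refine ⟨Complex.I ^ 1 • 1, I_pow_smul_mem 1 (one_mem _), fun ψ => ?_⟩
      simp [Matrix.mulVec_smul]
    · exact fun k => h _ (Or.inl ⟨k, rfl⟩)
    · exact fun k => h _ (Or.inr ⟨k, rfl⟩)
  revert P
  refine cliffordCircuits_induction (p := fun U => ∀ {P : Module.End ℂ (Vec A)},
    P ∈ pauliGroup A → ∃ Q ∈ pauliGroup A, ∀ ψ, P (U *ᵥ ψ) = U *ᵥ Q ψ) ?_ ?_ ?_ ?_ ?_ hU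
  · exact fun {P} hP => ⟨P, hP, fun ψ => by simp⟩
  · intro U V hU hV P hP
    obtain ⟨Q, hQ, e⟩ := hU hP
    obtain ⟨Q', hQ', e'⟩ := hV hQ
    exact ⟨Q', hQ', fun ψ => by rw [← Matrix.mulVec_mulVec, e, e', Matrix.mulVec_mulVec]⟩
  · exact fun j P hP => gate _ (fun P hP => pauli_comp_hadamardGate j hP) P hP
  · exact fun j P hP => gate _ (fun P hP => pauli_comp_phaseGate j hP) P hP
  · exact fun c t h P hP => gate _ (fun P hP => pauli_comp_cnotGate h hP) P hP

/-- The adjoint circuit is again Clifford, so normalization also moves Paulis in the other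
direction. -/
theorem clifford_comp_pauli {U : Op A} (hU : U ∈ cliffordCircuits A)
    {P : Module.End ℂ (Vec A)} (hP : P ∈ pauliGroup A) :
    ∃ Q ∈ pauliGroup A, ∀ ψ, U *ᵥ P ψ = Q (U *ᵥ ψ) := by
  obtain ⟨Q, hQ, e⟩ := pauli_comp_clifford (conjTranspose_mem_cliffordCircuits hU) hP
  refine ⟨Q, hQ, fun ψ => ?_⟩
  have := congrArg (U *ᵥ ·) (e (U *ᵥ ψ))
  simpa [Matrix.mulVec_mulVec, conjTranspose_mul_self_of_clifford hU,
    mul_conjTranspose_self_of_clifford hU] using this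

/-- Pauli operators permute the computational basis up to phases. -/
theorem pauli_single {P : Module.End ℂ (Vec A)} (hP : P ∈ pauliGroup A) :
    ∀ x : A → Fin 2, ∃ (k : ℕ) (y : A → Fin 2),
      P (Pi.single x 1) = Complex.I ^ k • Pi.single y (1 : ℂ) := by
  refine pauliGroup_induction (p := fun P => ∀ x : A → Fin 2, ∃ (k : ℕ) (y : A → Fin 2),
      P (Pi.single x 1) = Complex.I ^ k • Pi.single y (1 : ℂ)) ?_ ?_ ?_ ?_ ?_ hP
  · exact fun x => ⟨0, x, by simp⟩
  · intro P Q hP hQ x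
    obtain ⟨k, y, e⟩ := hQ x
    obtain ⟨l, z, e'⟩ := hP y
    exact ⟨k + l, z, by rw [Module.End.mul_apply, e, map_smul, e', smul_smul, pow_add]⟩
  · exact fun x => ⟨1, x, by simp⟩
  · intro j x
    refine ⟨0, Function.update x j (x j + 1), funext fun y => ?_⟩
    have : Function.update y j (y j + 1) = x ↔ y = Function.update x j (x j + 1) := by
      constructor <;> (rintro rfl; simp [fin_two_add_self])
    simp [bitFlip_apply, Pi.single_apply, this]
  · intro j x
    refine ⟨2 * (x j : ℕ), x, funext fun y => ?_⟩
    by_cases h : y = x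
    · subst h; simp [phaseFlip_apply, pow_mul]
    · simp [phaseFlip_apply, h]

end PauliConj

/-! ### Stabilizer vectors -/

section StabVec

variable {A : Type} [Fintype A] [DecidableEq A]

/-- Scalar multiples of the vectors `U |0…0⟩` with `U` Clifford. -/
def stabVec (A : Type) [Fintype A] [DecidableEq A] : Set (Vec A) :=
  {ψ | ∃ c : ℂ, ∃ U ∈ cliffordCircuits A, ψ = c • U *ᵥ Pi.single 0 1}

theorem zero_ket_mem : (Pi.single 0 1 : Vec A) ∈ stabVec A :=
  ⟨1, 1, one_mem _, by rw [Matrix.one_mulVec, one_smul]⟩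

theorem smul_mem_stabVec (c : ℂ) {ψ : Vec A} (h : ψ ∈ stabVec A) : c • ψ ∈ stabVec A := by
  obtain ⟨d, U, hU, rfl⟩ := h
  exact ⟨c * d, U, hU, by rw [mul_smul]⟩

/-- Admitting the zero vector lets projections be applied without checking that the outcome is
possible. -/
theorem zero_mem_stabVec : (0 : Vec A) ∈ stabVec A := by
  simpa using smul_mem_stabVec 0 (zero_ket_mem (A := A))

theorem mulVec_mem_stabVec {U : Op A} (hU : U ∈ cliffordCircuits A) {ψ : Vec A}
    (h : ψ ∈ stabVec A) : U *ᵥ ψ ∈ stabVec A := by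
  obtain ⟨d, V, hV, rfl⟩ := h
  exact ⟨d, U * V, mul_mem hU hV, by rw [Matrix.mulVec_smul, Matrix.mulVec_mulVec]⟩

theorem stabVec_induction {p : Vec A → Prop} (zero : p (Pi.single 0 1))
    (smul : ∀ (c : ℂ) ψ, p ψ → p (c • ψ)) (had : ∀ j ψ, p ψ → p (hadamardGate j *ᵥ ψ))
    (pha : ∀ j ψ, p ψ → p (phaseGate j *ᵥ ψ))
    (cnot : ∀ c t, c ≠ t → ∀ ψ, p ψ → p (cnotGate c t *ᵥ ψ))
    {ψ : Vec A} (h : ψ ∈ stabVec A) : p ψ := by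
  obtain ⟨c, U, hU, rfl⟩ := h
  refine smul _ _ (?_ : p (U *ᵥ Pi.single 0 1))
  have := cliffordCircuits_induction (p := fun U => ∀ ψ, p ψ → p (U *ᵥ ψ))
    (fun ψ h => by simpa using h)
    (fun U V hU hV ψ h => by rw [← Matrix.mulVec_mulVec]; exact hU _ (hV _ h)) had pha cnot hU
  exact this _ zero

/-! ### Preparing superpositions of two basis states -/

theorem cnotGate_single {c t : A} (h : c ≠ t) (y : A → Fin 2) :
    cnotGate c t *ᵥ (Pi.single y 1 : Vec A) =
      Pi.single (Function.update y t (y t + y c)) 1 := by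
  ext x
  rw [cnotGate_mulVec h]
  simp only [Pi.single_apply, eq_cnot_iff h x y]
  exact if_congr eq_comm rfl rfl

theorem phaseGate_single (j : A) (y : A → Fin 2) :
    phaseGate j *ᵥ (Pi.single y 1 : Vec A) = Complex.I ^ (y j : ℕ) • Pi.single y 1 := by
  ext x
  rw [phaseGate_mulVec]
  by_cases h : x = y
  · subst h; simp
  · simp [h]

theorem hadamardGate_zero_ket (j : A) :
    hadamardGate j *ᵥ (Pi.single 0 1 : Vec A) =
      ((Real.sqrt 2 : ℝ) : ℂ)⁻¹ • (Pi.single 0 1 + Pi.single (Pi.single j 1) 1) := by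
  ext x
  rw [hadamardGate_mulVec]
  have h0 : Function.update x j 1 ≠ 0 := fun h => by simpa using congrFun h j
  have h1 : Function.update x j 0 = 0 ↔ x = 0 ∨ x = Pi.single j 1 := by
    constructor
    · intro h
      rcases fin_two_cases (x j) with hj | hj
      · left; rw [← h, ← hj, Function.update_eq_self]
      · right
        ext k : 1
        by_cases hk : k = j
        · subst hk; simp [hj]
        · simpa [hk] using congrFun h k
    · rintro (rfl | rfl)
      · simp
      · ext k : 1
        by_cases hk : k = j
        · subst hk; simp
        · simp [hk]
  have h2 : (0 : A → Fin 2) ≠ Pi.single j 1 := fun h => by simpa using congrFun h j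
  simp only [Pi.single_apply, if_neg h0, h1, Pi.smul_apply, Pi.add_apply, smul_eq_mul]
  by_cases e0 : x = 0
  · simp [e0, h2]
  · by_cases e1 : x = Pi.single j 1 <;> simp [e0, e1, h2.symm]

/-- A Hadamard on qubit `j` gives the case `k = 0`, and every further phase gate on `j` contributes
one factor `i`. -/
theorem zero_ket_add_phase_single_mem (k : ℕ) (j : A) :
    Pi.single 0 1 + Complex.I ^ k • Pi.single (Pi.single j 1) 1 ∈ stabVec A := by
  induction k with
  | zero =>
    have := smul_mem_stabVec ((Real.sqrt 2 : ℝ) : ℂ)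
      (mulVec_mem_stabVec (hadamardGate_mem j) zero_ket_mem)
    rw [hadamardGate_zero_ket, smul_smul, mul_inv_cancel₀ sqrt_two_ne, one_smul] at this
    simpa using this
  | succ k ih =>
    have := mulVec_mem_stabVec (phaseGate_mem j) ih
    rw [Matrix.mulVec_add, Matrix.mulVec_smul, phaseGate_single, phaseGate_single, smul_smul]
      at this
    simpa [← pow_succ] using this

/-- Pick a pivot `j` with `x j = 1`, prepare the superposition on that qubit alone, and copy its bit
by CNOTs to the other ones of `x`. These CNOTs fix `|0…0⟩`. -/
theorem zero_ket_add_phase_ket_mem (k : ℕ) (x : A → Fin 2) :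
    Pi.single 0 1 + Complex.I ^ k • Pi.single x 1 ∈ stabVec A := by
  by_cases hx : x = 0
  · subst hx
    have := smul_mem_stabVec (1 + Complex.I ^ k) (zero_ket_mem (A := A))
    rwa [add_smul, one_smul] at this
  obtain ⟨j, hj⟩ := Function.ne_iff.mp hx
  have hj : x j = 1 := (fin_two_cases (x j)).resolve_left hj
  -- `J` collects the target qubits already set to their value in `x`; a target with `x t = 0` needs
  -- no gate.
  have key : ∀ J : Finset A, j ∉ J → Pi.single 0 1 + Complex.I ^ k •
      Pi.single (fun l => if l = j ∨ l ∈ J then x l else 0) 1 ∈ stabVec A := by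
    intro J
    induction J using Finset.induction_on with
    | empty =>
      intro _
      convert zero_ket_add_phase_single_mem k j using 5 with l
      by_cases h : l = j
      · subst h; simp [hj]
      · simp [h]
    | insert t J ht ih =>
      intro hjJ
      rw [Finset.mem_insert, not_or] at hjJ
      have ih := ih hjJ.2
      rcases fin_two_cases (x t) with h0 | h1
      · convert ih using 5 with l
        by_cases h : l = t
        · subst h; simp [h0]
        · simp [h]
      · have := mulVec_mem_stabVec (cnotGate_mem hjJ.1) ih
        rw [Matrix.mulVec_add, Matrix.mulVec_smul, cnotGate_single hjJ.1,
          cnotGate_single hjJ.1] at this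
        convert this using 3
        · simp
        · congr 1
          ext l : 1
          by_cases h : l = t
          · subst h; simp [h1, hj, ht, Ne.symm hjJ.1]
          · simp [h]
  convert key (Finset.univ.erase j) (by simp) using 5 with l
  by_cases h : l = j <;> simp [h]

/-- With `P U = U Q` and `Q|0⟩ = i^k|x⟩` one has `(1 + P) U|0⟩ = U(|0⟩ + i^k|x⟩)`. For a Hermitian
Pauli `P`, half of the result is the projection of `ψ` onto its `+1` eigenspace. -/
theorem one_add_pauli_mem_stabVec {P : Module.End ℂ (Vec A)} (hP : P ∈ pauliGroup A)
    {ψ : Vec A} (h : ψ ∈ stabVec A) : ψ + P ψ ∈ stabVec A := by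
  obtain ⟨c, U, hU, rfl⟩ := h
  obtain ⟨Q, hQ, e⟩ := pauli_comp_clifford hU hP
  obtain ⟨k, x, ex⟩ := pauli_single hQ 0
  have := smul_mem_stabVec c (mulVec_mem_stabVec hU (zero_ket_add_phase_ket_mem k x))
  rwa [Matrix.mulVec_add, ← ex, ← e, smul_add, ← map_smul] at this

theorem ket_mem_stabVec (x : A → Fin 2) : (Pi.single x 1 : Vec A) ∈ stabVec A := by
  by_cases hx : x = 0
  · subst hx; exact zero_ket_mem
  obtain ⟨j, hj⟩ := Function.ne_iff.mp hx
  have hj : x j = 1 := (fin_two_cases (x j)).resolve_left hj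
  have h1 := zero_ket_add_phase_ket_mem 0 x
  -- The projection `(1 - Z_j)/2` removes `|0⟩` from `|0⟩ + |x⟩` and keeps `|x⟩`, as `x j = 1`.
  have h2 := smul_mem_stabVec (1 / 2)
    (one_add_pauli_mem_stabVec (neg_one_pow_smul_mem 1 (phaseFlip_mem j)) h1)
  convert h2 using 1
  ext y
  by_cases e : y = x
  · subst e
    simp [phaseFlip_apply, hj, hx]
    norm_num
  · by_cases e0 : y = 0
    · subst e0; simp [phaseFlip_apply, e]
    · simp [phaseFlip_apply, e, e0]

/-! ### Slices of stabilizer vectors -/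

variable {B R : Type} [Fintype B] [DecidableEq B] [Fintype R] [DecidableEq R]

/-- The map `χ ↦ χ ⊗ |s⟩`. -/
def tensorKet (B : Type) {R : Type} [Fintype R] (s : R → Fin 2) (χ : Vec B) :
    Vec (B ⊕ R) :=
  fun p => if p ∘ Sum.inr = s then χ (p ∘ Sum.inl) else 0

omit [Fintype B] [DecidableEq B] [DecidableEq R] in
@[simp] theorem tensorKet_elim (s s' : R → Fin 2) (χ : Vec B) (x : B → Fin 2) :
    tensorKet B s χ (Sum.elim x s') = if s' = s then χ x else 0 := rfl

omit [Fintype B] [DecidableEq B] [Fintype R] [DecidableEq R] in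
theorem vec_ext {χ χ' : Vec (B ⊕ R)} (h : ∀ x s, χ (Sum.elim x s) = χ' (Sum.elim x s)) :
    χ = χ' := by
  ext p
  rw [← Sum.elim_comp_inl_inr p]
  exact h _ _

/-- The projector `1 ⊗ |s⟩⟨s|` is the product over `r` of `(1 + (-1)^{s_r} Z_r)/2`, and each factor
preserves stabilizer vectors. -/
theorem project_mem_stabVec {ψ : Vec (B ⊕ R)} (h : ψ ∈ stabVec (B ⊕ R)) (s : R → Fin 2) :
    tensorKet B s (fun x => ψ (Sum.elim x s)) ∈ stabVec (B ⊕ R) := by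
  have key : ∀ J : Finset R, (fun p => if ∀ r ∈ J, p (Sum.inr r) = s r then ψ p else 0) ∈
      stabVec (B ⊕ R) := by
    intro J
    induction J using Finset.induction_on with
    | empty => simpa using h
    | insert r J _ ih =>
      have := smul_mem_stabVec (1 / 2) (one_add_pauli_mem_stabVec
        (neg_one_pow_smul_mem (s r : ℕ) (phaseFlip_mem (Sum.inr r : B ⊕ R))) ih)
      convert this using 1
      ext p
      simp only [Finset.forall_mem_insert, Pi.smul_apply, Pi.add_apply, LinearMap.smul_apply,
        phaseFlip_apply, smul_eq_mul]
      by_cases hJ : ∀ r ∈ J, p (Sum.inr r) = s r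
      · simp only [if_pos hJ, and_iff_left hJ]
        rcases fin_two_cases (p (Sum.inr r)) with h1 | h1 <;>
          rcases fin_two_cases (s r) with h2 | h2 <;> simp [h1, h2] <;> ring
      · simp only [if_neg hJ, if_neg fun h : p (Sum.inr r) = s r ∧ _ => hJ h.2]
        simp
  convert key Finset.univ using 1
  refine vec_ext fun x s' => ?_
  have hs : (∀ r ∈ Finset.univ, s' r = s r) ↔ s' = s := by simp [funext_iff]
  simp only [tensorKet_elim, Sum.elim_inr, hs]
  split_ifs with h
  · rw [h]
  · rfl

-- A Pauli operator is a product of a Pauli on `B` and one on `R`; the latter moves `|s⟩` to a basis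
-- state, with a phase that is absorbed into `Q`.
omit [Fintype B] in
theorem pauli_tensorKet {P : Module.End ℂ (Vec (B ⊕ R))} (hP : P ∈ pauliGroup (B ⊕ R)) :
    ∀ s : R → Fin 2, ∃ s' : R → Fin 2, ∃ Q ∈ pauliGroup B,
      ∀ χ, P (tensorKet B s χ) = tensorKet B s' (Q χ) := by
  refine pauliGroup_induction (p := fun P => ∀ s : R → Fin 2, ∃ s' : R → Fin 2,
    ∃ Q ∈ pauliGroup B, ∀ χ, P (tensorKet B s χ) = tensorKet B s' (Q χ)) ?_ ?_ ?_ ?_ ?_ hP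
  · exact fun s => ⟨s, 1, one_mem _, fun χ => rfl⟩
  · intro P₁ P₂ h₁ h₂ s
    obtain ⟨s', Q, hQ, e⟩ := h₂ s
    obtain ⟨s'', Q', hQ', e'⟩ := h₁ s'
    exact ⟨s'', Q' * Q, mul_mem hQ' hQ, fun χ => by simp [e, e']⟩
  · refine fun s => ⟨s, Complex.I ^ 1 • 1, I_pow_smul_mem 1 (one_mem _), fun χ => ?_⟩
    refine vec_ext fun x t => ?_
    simp
  · rintro (b | r) s
    · refine ⟨s, bitFlip b, bitFlip_mem b, fun χ => vec_ext fun x t => ?_⟩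
      simp only [bitFlip_apply, Sum.elim_inl, Sum.update_elim_inl, tensorKet_elim]
    · refine ⟨Function.update s r (s r + 1), 1, one_mem _, fun χ => vec_ext fun x t => ?_⟩
      have : Function.update t r (t r + 1) = s ↔ t = Function.update s r (s r + 1) := by
        constructor <;> (rintro rfl; simp [fin_two_add_self])
      simp only [bitFlip_apply, Sum.elim_inr, Sum.update_elim_inr, tensorKet_elim, this,
        Module.End.one_apply]
  · rintro (b | r) s
    · refine ⟨s, phaseFlip b, phaseFlip_mem b, fun χ => vec_ext fun x t => ?_⟩
      simp [phaseFlip_apply]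
    · refine ⟨s, (-1 : ℂ) ^ (s r : ℕ) • 1, neg_one_pow_smul_mem _ (one_mem _),
        fun χ => vec_ext fun x t => ?_⟩
      simp only [phaseFlip_apply, tensorKet_elim, Sum.elim_inr, LinearMap.smul_apply,
        Module.End.one_apply, Pi.smul_apply, smul_eq_mul]
      split_ifs with h
      · rw [h]
      · simp

/-- Restricting a stabilizer vector to a computational basis state of a subregister gives a
stabilizer vector. -/
theorem slice_mem_stabVec {ψ : Vec (B ⊕ R)} (h : ψ ∈ stabVec (B ⊕ R)) (s : R → Fin 2) :
    (fun x => ψ (Sum.elim x s)) ∈ stabVec B := by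
  have hproj := project_mem_stabVec h s
  set φ : Vec B := fun x => ψ (Sum.elim x s) with hφ
  clear_value φ
  -- From here on `φ` is nonzero, so it overlaps some basis state `x`, and `φ ⊗ |s⟩ = c U|0⟩`.
  by_cases h0 : φ = 0
  · rw [h0]; exact zero_mem_stabVec
  obtain ⟨x, hx⟩ := Function.ne_iff.mp h0
  obtain ⟨c, U, hU, e⟩ := hproj
  -- `g = U Z_j U†` is a Pauli stabilizing `φ ⊗ |s⟩`. As that vector is nonzero, `g` cannot move
  -- `|s⟩`, so on vectors `χ ⊗ |s⟩` it acts as a Pauli on `B` alone.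
  have stab : ∀ j χ, χ ∈ stabVec B → ∃ χ' ∈ stabVec B,
      tensorKet B s χ + U *ᵥ phaseFlip j (Uᴴ *ᵥ tensorKet B s χ) = tensorKet B s χ' := by
    intro j χ hχ
    obtain ⟨g, hg, eg⟩ := clifford_comp_pauli hU (phaseFlip_mem j)
    obtain ⟨s', Q, hQ, eQ⟩ := pauli_tensorKet hg s
    have hfix : g (tensorKet B s φ) = tensorKet B s φ := by
      rw [e, map_smul, ← eg]
      congr 2
      ext y
      by_cases hy : y = 0
      · subst hy; simp [phaseFlip_apply]
      · simp [phaseFlip_apply, hy]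
    have hs : s' = s := by
      by_contra hne
      have := congrFun hfix (Sum.elim x s)
      rw [eQ, tensorKet_elim, tensorKet_elim, if_neg (Ne.symm hne), if_pos rfl] at this
      exact hx this.symm
    subst hs
    refine ⟨_, one_add_pauli_mem_stabVec hQ hχ, ?_⟩
    rw [eg, Matrix.mulVec_mulVec, mul_conjTranspose_self_of_clifford hU, Matrix.one_mulVec, eQ]
    refine vec_ext fun x t => ?_
    simp only [Pi.add_apply, tensorKet_elim]
    split_ifs <;> simp
  -- The projector `U|0⟩⟨0|U†` is the product of the `(1 + U Z_j U†)/2`. Applied one by one to `|x⟩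
  -- ⊗ |s⟩`, these factors act within `B`; `J` holds the indices already used.
  have key : ∀ J : Finset (B ⊕ R), ∃ χ ∈ stabVec B,
      (U *ᵥ fun p => if ∀ j ∈ J, p j = 0 then
        (Uᴴ *ᵥ tensorKet B s (Pi.single x 1)) p else 0) = tensorKet B s χ := by
    intro J
    induction J using Finset.induction_on with
    | empty =>
      refine ⟨_, ket_mem_stabVec x, ?_⟩
      simp [Matrix.mulVec_mulVec, mul_conjTranspose_self_of_clifford hU]
    | insert j J _ ih =>
      obtain ⟨χ, hχ, eχ⟩ := ih
      obtain ⟨χ', hχ', eχ'⟩ := stab j χ hχ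
      refine ⟨_, smul_mem_stabVec (1 / 2) hχ', ?_⟩
      have e2 : tensorKet B s ((1 / 2 : ℂ) • χ') = (1 / 2 : ℂ) • tensorKet B s χ' :=
        vec_ext fun x t => by simp
      rw [e2, ← eχ', ← eχ, Matrix.mulVec_mulVec, conjTranspose_mul_self_of_clifford hU,
        Matrix.one_mulVec, ← Matrix.mulVec_add, ← Matrix.mulVec_smul]
      congr 1
      ext p
      simp only [Finset.forall_mem_insert, Pi.smul_apply, Pi.add_apply, phaseFlip_apply,
        smul_eq_mul]
      by_cases hJ : ∀ j ∈ J, p j = 0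
      · simp only [if_pos hJ, and_iff_left hJ]
        rcases fin_two_cases (p j) with h1 | h1 <;> simp [h1]
        ring
      · simp only [if_neg hJ, if_neg fun h : p j = 0 ∧ _ => hJ h.2]
        simp
  obtain ⟨χ, hχ, eχ⟩ := key Finset.univ
  -- Once all factors are used, only the overlap of `U|0⟩` with `|x⟩ ⊗ |s⟩` remains as a
  -- coefficient.
  have e1 : (fun p : B ⊕ R → Fin 2 => if ∀ j ∈ Finset.univ, p j = 0 then
      (Uᴴ *ᵥ tensorKet B s (Pi.single x 1)) p else 0) =
      (star (U (Sum.elim x s) 0)) • Pi.single 0 1 := by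
    have : tensorKet B s (Pi.single x 1) = Pi.single (Sum.elim x s) 1 := by
      refine vec_ext fun y t => ?_
      simp only [tensorKet_elim, Pi.single_apply, Sum.elim_eq_iff]
      by_cases h1 : t = s <;> simp [h1]
    ext p
    have h2 : (∀ j ∈ Finset.univ, p j = 0) ↔ p = 0 := by simp [funext_iff]
    simp only [h2, this, Matrix.mulVec_single_one]
    by_cases hp : p = 0
    · subst hp; simp
    · simp [hp]
  rw [e1, Matrix.mulVec_smul] at eχ
  have hxe := congrFun e (Sum.elim x s)
  simp only [tensorKet_elim, if_true, Pi.smul_apply, Matrix.mulVec_single_one,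
    Matrix.col_apply, smul_eq_mul] at hxe
  -- The choice of `x` makes this overlap nonzero, so dividing by it recovers `φ` as a multiple of
  -- `χ`.
  have hα : star (U (Sum.elim x s) 0) ≠ 0 := by
    intro h
    rw [star_eq_zero] at h
    rw [h, mul_zero] at hxe
    exact hx hxe
  have : φ = (c * (star (U (Sum.elim x s) 0))⁻¹) • χ := by
    ext y
    have h1 := congrFun e (Sum.elim y s)
    have h2 := congrFun eχ (Sum.elim y s)
    simp only [tensorKet_elim, if_true, Pi.smul_apply, smul_eq_mul] at h1 h2 ⊢
    rw [h1, ← h2]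
    field_simp
  rw [this]
  exact smul_mem_stabVec _ hχ

end StabVec

/-! ### Renaming qubits and tensor products -/

section TensorVec

variable {A B R : Type} [Fintype A] [DecidableEq A] [Fintype B] [DecidableEq B]
  [Fintype R] [DecidableEq R]

omit [Fintype A] [Fintype B] in
theorem update_comp_equiv (e : A ≃ B) (x : B → Fin 2) (j : A) (b : Fin 2) :
    (fun a => Function.update x (e j) b (e a)) = Function.update (fun a => x (e a)) j b :=
  Function.update_comp_eq_of_injective x e.injective j b

theorem relabel_mem_stabVec (e : A ≃ B) {ψ : Vec A} (h : ψ ∈ stabVec A) :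
    (fun x : B → Fin 2 => ψ fun a => x (e a)) ∈ stabVec B := by
  refine stabVec_induction (p := fun ψ => (fun x : B → Fin 2 => ψ fun a => x (e a)) ∈ stabVec B)
    ?_ ?_ ?_ ?_ ?_ h
  · convert zero_ket_mem (A := B) using 1
    ext x
    have : (fun a => x (e a)) = 0 ↔ x = 0 := by
      simp [funext_iff, e.forall_congr_left]
    simp [Pi.single_apply, this]
  · exact fun c ψ h => smul_mem_stabVec c h
  · intro j ψ h
    convert mulVec_mem_stabVec (hadamardGate_mem (e j)) h using 1
    ext x
    simp only [hadamardGate_mulVec, update_comp_equiv]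
  · intro j ψ h
    convert mulVec_mem_stabVec (phaseGate_mem (e j)) h using 1
    ext x
    simp only [phaseGate_mulVec]
  · intro c t hct ψ h
    have hct' : e c ≠ e t := fun he => hct (e.injective he)
    convert mulVec_mem_stabVec (cnotGate_mem hct') h using 1
    ext x
    simp only [cnotGate_mulVec hct, cnotGate_mulVec hct', update_comp_equiv]

theorem sum_elim {M : Type*} [AddCommMonoid M] (f : (A ⊕ B → Fin 2) → M) :
    ∑ p, f p = ∑ x : A → Fin 2, ∑ y : B → Fin 2, f (Sum.elim x y) := by
  rw [← Fintype.sum_prod_type']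
  exact Fintype.sum_equiv (Equiv.sumArrowEquivProdArrow A B (Fin 2)) _ _
    fun p => by simp [Equiv.sumArrowEquivProdArrow]

omit [Fintype A] [DecidableEq A] [Fintype B] [DecidableEq B] in
@[simp] theorem tensor_elim (ρ : Op A) (σ : Op B) (x x' : A → Fin 2) (y y' : B → Fin 2) :
    tensor ρ σ (Sum.elim x y) (Sum.elim x' y') = ρ x x' * σ y y' := rfl

theorem tensor_one_mulVec (U : Op B) (ψ : Vec (A ⊕ B)) (x : A → Fin 2) (y : B → Fin 2) :
    (tensor (1 : Op A) U *ᵥ ψ) (Sum.elim x y) = (U *ᵥ fun y' => ψ (Sum.elim x y')) y := by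
  simp [Matrix.mulVec, dotProduct, sum_elim, Matrix.one_apply]

theorem op_ext_of_mulVec {M N : Op A} (h : ∀ ψ : Vec A, M *ᵥ ψ = N *ᵥ ψ) : M = N :=
  Matrix.ext_of_mulVec_single fun _ => h _

theorem tensor_one_mul (U V : Op B) :
    tensor (1 : Op A) (U * V) = tensor 1 U * tensor 1 V := by
  refine op_ext_of_mulVec fun ψ => vec_ext fun x y => ?_
  simp only [← Matrix.mulVec_mulVec, tensor_one_mulVec]

theorem tensor_one_mem_cliffordCircuits {U : Op B} (hU : U ∈ cliffordCircuits B) :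
    tensor (1 : Op A) U ∈ cliffordCircuits (A ⊕ B) := by
  refine cliffordCircuits_induction (p := fun U => tensor (1 : Op A) U ∈ cliffordCircuits (A ⊕ B))
    ?_ ?_ ?_ ?_ ?_ hU
  · convert one_mem (cliffordCircuits (A ⊕ B))
    refine op_ext_of_mulVec fun ψ => vec_ext fun x y => ?_
    rw [tensor_one_mulVec, Matrix.one_mulVec, Matrix.one_mulVec]
  · intro U V hU hV
    rw [tensor_one_mul]
    exact mul_mem hU hV
  · intro j
    convert hadamardGate_mem (Sum.inr j : A ⊕ B)
    refine op_ext_of_mulVec fun ψ => vec_ext fun x y => ?_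
    simp only [tensor_one_mulVec, hadamardGate_mulVec, Sum.update_elim_inr, Sum.elim_inr]
  · intro j
    convert phaseGate_mem (Sum.inr j : A ⊕ B)
    refine op_ext_of_mulVec fun ψ => vec_ext fun x y => ?_
    simp only [tensor_one_mulVec, phaseGate_mulVec, Sum.elim_inr]
  · intro c t h
    have h' : (Sum.inr c : A ⊕ B) ≠ Sum.inr t := by simpa using h
    convert cnotGate_mem h'
    refine op_ext_of_mulVec fun ψ => vec_ext fun x y => ?_
    simp only [tensor_one_mulVec, cnotGate_mulVec h, cnotGate_mulVec h', Sum.update_elim_inr,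
      Sum.elim_inr]

/-- The tensor product of vectors. -/
def tensorVec (ψ : Vec A) (φ : Vec B) : Vec (A ⊕ B) :=
  fun p => ψ (fun a => p (Sum.inl a)) * φ (fun b => p (Sum.inr b))

omit [Fintype A] [DecidableEq A] [Fintype B] [DecidableEq B] in
theorem tensorVec_elim (ψ : Vec A) (φ : Vec B) (x : A → Fin 2) (y : B → Fin 2) :
    tensorVec ψ φ (Sum.elim x y) = ψ x * φ y := rfl

theorem tensorVec_mulVec (ψ : Vec A) (U : Op B) (φ : Vec B) :
    tensorVec ψ (U *ᵥ φ) = tensor (1 : Op A) U *ᵥ tensorVec ψ φ := by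
  refine vec_ext fun x y => ?_
  rw [tensor_one_mulVec]
  exact (congrFun (Matrix.mulVec_smul U (ψ x) φ) y).symm

/-- The two preparing circuits are run one after the other on `|0⟩ ⊗ |0⟩`. Only the right factor is
treated directly; `right` quantifies over registers so that it also serves the left factor after a
swap. -/
theorem tensorVec_mem_stabVec {ψ : Vec A} {φ : Vec B} (hψ : ψ ∈ stabVec A)
    (hφ : φ ∈ stabVec B) : tensorVec ψ φ ∈ stabVec (A ⊕ B) := by
  have right : ∀ {A B : Type} [Fintype A] [DecidableEq A] [Fintype B] [DecidableEq B]
      {ψ : Vec A} {φ : Vec B}, tensorVec ψ (Pi.single 0 1 : Vec B) ∈ stabVec (A ⊕ B) →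
      φ ∈ stabVec B → tensorVec ψ φ ∈ stabVec (A ⊕ B) := by
    intro A B _ _ _ _ ψ φ h hφ
    obtain ⟨c, U, hU, rfl⟩ := hφ
    convert smul_mem_stabVec c (mulVec_mem_stabVec (tensor_one_mem_cliffordCircuits hU) h) using 1
    rw [← tensorVec_mulVec]
    ext p
    simp [tensorVec, mul_left_comm]
  have zero : tensorVec (Pi.single 0 1 : Vec B) (Pi.single 0 1 : Vec A) ∈ stabVec (B ⊕ A) := by
    convert zero_ket_mem (A := B ⊕ A) using 1
    refine vec_ext fun x y => ?_
    have : (Sum.elim x y : B ⊕ A → Fin 2) = 0 ↔ x = 0 ∧ y = 0 := by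
      simp [funext_iff]
    simp only [tensorVec_elim, Pi.single_apply, this]
    by_cases hx : x = 0 <;> by_cases hy : y = 0 <;> simp [hx, hy]
  refine right ?_ hφ
  convert relabel_mem_stabVec (Equiv.sumComm B A) (right zero hψ) using 1
  ext p
  simp [tensorVec, mul_comm]

end TensorVec

/-! ### The Bell basis -/

section Bell

variable {A B R : Type} [Fintype A] [DecidableEq A] [Fintype B] [DecidableEq B]
  [Fintype R] [DecidableEq R]

/-- The vector that is a product over the pairs `(j', j)` of the two-qubit vectors `f j`. -/
def pairProduct (f : A → Fin 2 → Fin 2 → ℂ) : Vec (A ⊕ A) :=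
  fun p => ∏ j, f j (p (Sum.inl j)) (p (Sum.inr j))

/-- The Bell basis change of a pair of qubits. -/
noncomputable def bellUnitary (j : A) : Op (A ⊕ A) :=
  hadamardGate (Sum.inl j) * cnotGate (Sum.inl j) (Sum.inr j)

theorem bellUnitary_mem (j : A) : bellUnitary j ∈ hadamardCnotCircuits (A ⊕ A) :=
  mul_mem (Submonoid.subset_closure (Or.inl ⟨_, rfl⟩))
    (Submonoid.subset_closure (Or.inr ⟨_, _, Sum.inl_ne_inr, rfl⟩))

/-- Only the factor of pair `j` changes. The shift `b + 1` in the second term comes from the CNOT,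
which acts before the Hadamard. -/
theorem bellUnitary_pairProduct (j : A) (f : A → Fin 2 → Fin 2 → ℂ) :
    bellUnitary j *ᵥ pairProduct f = pairProduct (Function.update f j fun a b =>
      (f j 0 b + (-1) ^ (a : ℕ) * f j 1 (b + 1)) / ((Real.sqrt 2 : ℝ) : ℂ)) := by
  refine vec_ext fun x y => ?_
  have off : ∀ (a b : Fin 2) (g : Fin 2 → Fin 2 → ℂ),
      pairProduct (Function.update f j g) (Sum.elim (Function.update x j a)
        (Function.update y j b)) =
      g a b * ∏ k ∈ Finset.univ.erase j, f k (x k) (y k) := by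
    intro a b g
    rw [pairProduct, ← Finset.mul_prod_erase _ _ (Finset.mem_univ j)]
    congr 1
    · simp
    · refine Finset.prod_congr rfl fun k hk => ?_
      have := Finset.ne_of_mem_erase hk
      simp [this]
  have h1 := fun a b => off a b (f j)
  have h2 := off (x j) (y j)
  simp only [Function.update_eq_self] at h1 h2
  rw [h2, bellUnitary, ← Matrix.mulVec_mulVec]
  simp only [hadamardGate_mulVec, cnotGate_mulVec Sum.inl_ne_inr, Sum.update_elim_inl,
    Sum.update_elim_inr, Sum.elim_inl, Sum.elim_inr, Function.update_self, h1]
  rw [add_zero]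
  ring

theorem exists_bell_circuit (A : Type) [Fintype A] [DecidableEq A] :
    ∃ U ∈ hadamardCnotCircuits (A ⊕ A),
      ∀ s : A ⊕ A → Fin 2, U *ᵥ bellVector s = Pi.single s 1 := by
  -- The pairs in `J` are already disentangled into basis states, the others are still Bell pairs.
  -- One circuit must serve all `s` at once.
  have key : ∀ J : Finset A, ∃ U ∈ hadamardCnotCircuits (A ⊕ A),
      ∀ s : A ⊕ A → Fin 2, U *ᵥ bellVector s = pairProduct fun j a b =>
        if j ∈ J then (if a = s (Sum.inl j) ∧ b = s (Sum.inr j) then 1 else 0) else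
          if b = a + s (Sum.inr j) then
            (-1 : ℂ) ^ ((s (Sum.inl j) : ℕ) * (a : ℕ)) / ((Real.sqrt 2 : ℝ) : ℂ) else 0 := by
    intro J
    induction J using Finset.induction_on with
    | empty => exact ⟨1, one_mem _, fun s => by simp [bellVector, pairProduct, funext_iff]⟩
    | insert j J hj ih =>
      obtain ⟨U, hU, e⟩ := ih
      refine ⟨bellUnitary j * U, mul_mem (bellUnitary_mem j) hU, fun s => ?_⟩
      rw [← Matrix.mulVec_mulVec, e, bellUnitary_pairProduct]
      congr 1
      ext k a b
      by_cases hk : k = j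
      · subst hk
        have hs := sqrt_two_sq
        have hn := sqrt_two_ne
        simp only [Function.update_self, hj, if_false, Finset.mem_insert_self, if_true]
        have : b + 1 = 1 + s (Sum.inr k) ↔ b = s (Sum.inr k) := by
          rw [add_comm, add_right_inj]
        simp only [this, zero_add]
        by_cases hb : b = s (Sum.inr k)
        · rcases fin_two_cases a with ha | ha <;>
            rcases fin_two_cases (s (Sum.inl k)) with hz | hz <;>
            simp [ha, hz, hb] <;> field_simp <;> (try rw [pow_two, hs]) <;> norm_num
        · simp [hb]
      · simp [hk]
  obtain ⟨U, hU, e⟩ := key Finset.univ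
  refine ⟨U, hU, fun s => ?_⟩
  rw [e]
  ext p
  have : (∀ j, p (Sum.inl j) = s (Sum.inl j) ∧ p (Sum.inr j) = s (Sum.inr j)) ↔ p = s := by
    simp [funext_iff, forall_and]
  simp only [pairProduct, Finset.mem_univ, if_true, Finset.prod_ite_zero, forall_true_left,
    this, Pi.single_apply, Finset.prod_const_one]

theorem bellVector_zero_elim (x y : A → Fin 2) :
    bellVector 0 (Sum.elim x y) =
      if x = y then (((Real.sqrt 2 : ℝ) : ℂ)⁻¹) ^ Fintype.card A else 0 := by
  have : (∀ j, y j = x j) ↔ x = y := by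
    rw [eq_comm (a := x), funext_iff]
  simp [bellVector, Finset.prod_ite_zero, this]

/-- By unitarity `⟨0|U` is the adjoint of `U†|0⟩`, which is the Bell vector; its entries are real,
so no conjugation survives. -/
theorem bell_circuit_zero_row {U : Op (A ⊕ A)} (hU : U ∈ cliffordCircuits (A ⊕ A))
    (e : U *ᵥ bellVector 0 = Pi.single 0 1) (p : A ⊕ A → Fin 2) : U 0 p = bellVector 0 p := by
  have h := congrArg (Uᴴ *ᵥ ·) e
  simp only [Matrix.mulVec_mulVec, conjTranspose_mul_self_of_clifford hU, Matrix.one_mulVec,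
    Matrix.mulVec_single_one] at h
  have hp := congrFun h p
  rw [Matrix.col_apply, Matrix.conjTranspose_apply] at hp
  rw [← star_star (U 0 p), ← hp, ← Sum.elim_comp_inl_inr p, bellVector_zero_elim]
  split_ifs
  · simp [Complex.conj_ofReal]
  · simp

/-- Outcome zero after the Bell circuit is the bra of the Bell vector: it sets the two copies equal
and sums, with amplitude `2^(-n/2)`. -/
theorem bell_circuit_slice {U : Op (A ⊕ A)} (hU : U ∈ cliffordCircuits (A ⊕ A))
    (e : U *ᵥ bellVector 0 = Pi.single 0 1) (ψ : Vec (B ⊕ (A ⊕ A))) (x : B → Fin 2) :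
    (tensor (1 : Op B) U *ᵥ ψ) (Sum.elim x 0) =
      (((Real.sqrt 2 : ℝ) : ℂ)⁻¹) ^ Fintype.card A *
        ∑ a, ψ (Sum.elim x (Sum.elim a a)) := by
  rw [tensor_one_mulVec]
  simp [Matrix.mulVec, dotProduct, bell_circuit_zero_row hU e, sum_elim, bellVector_zero_elim,
    Finset.mul_sum]

/-- The reordering of registers that brings a contracted pair of registers to the end. -/
def contractEquiv (B A R : Type) : (B ⊕ A) ⊕ (A ⊕ R) ≃ (B ⊕ R) ⊕ (A ⊕ A) where
  toFun
    | Sum.inl (Sum.inl b) => Sum.inl (Sum.inl b)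
    | Sum.inl (Sum.inr a) => Sum.inr (Sum.inl a)
    | Sum.inr (Sum.inl a) => Sum.inr (Sum.inr a)
    | Sum.inr (Sum.inr r) => Sum.inl (Sum.inr r)
  invFun
    | Sum.inl (Sum.inl b) => Sum.inl (Sum.inl b)
    | Sum.inr (Sum.inl a) => Sum.inl (Sum.inr a)
    | Sum.inr (Sum.inr a) => Sum.inr (Sum.inl a)
    | Sum.inl (Sum.inr r) => Sum.inr (Sum.inr r)
  left_inv := by rintro ((_ | _) | (_ | _)) <;> rfl
  right_inv := by rintro ((_ | _) | (_ | _)) <;> rfl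

/-- Contracting a common register of two stabilizer vectors gives a stabilizer vector. -/
theorem contract_mem_stabVec {ψ : Vec (B ⊕ A)} {φ : Vec (A ⊕ R)} (hψ : ψ ∈ stabVec (B ⊕ A))
    (hφ : φ ∈ stabVec (A ⊕ R)) :
    (fun q : B ⊕ R → Fin 2 => ∑ a, ψ (Sum.elim (fun b => q (Sum.inl b)) a) *
      φ (Sum.elim a fun r => q (Sum.inr r))) ∈ stabVec (B ⊕ R) := by
  obtain ⟨U, hU, e⟩ := exists_bell_circuit A
  have hU' := hadamardCnotCircuits_le hU
  -- Bell postselection on the two shared copies of the product vector; the scalar it introduces is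
  -- divided out next.
  have h := slice_mem_stabVec (mulVec_mem_stabVec (tensor_one_mem_cliffordCircuits hU')
    (relabel_mem_stabVec (contractEquiv B A R) (tensorVec_mem_stabVec hψ hφ))) 0
  simp only [bell_circuit_slice hU' (e 0)] at h
  have h2 := smul_mem_stabVec (((((Real.sqrt 2 : ℝ) : ℂ)⁻¹) ^ Fintype.card A)⁻¹) h
  convert h2 using 1
  ext q
  rw [Pi.smul_apply, smul_eq_mul, inv_mul_cancel_left₀
    (pow_ne_zero _ (inv_ne_zero sqrt_two_ne))]
  refine Finset.sum_congr rfl fun a _ => ?_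
  simp only [tensorVec]
  congr 2 <;> (ext (_ | _) <;> rfl)

end Bell

/-! ### The cone of unnormalized stabilizer states -/

section Cone

variable {A B R : Type} [Fintype A] [DecidableEq A] [Fintype B] [DecidableEq B]
  [Fintype R] [DecidableEq R]

/-- The operator `|ψ⟩⟨ψ|`. -/
def pureOp (ψ : Vec A) : Op A := Matrix.vecMulVec ψ (star ψ)

omit [Fintype A] [DecidableEq A] in
theorem pureOp_apply (ψ : Vec A) (x y : A → Fin 2) : pureOp ψ x y = ψ x * star (ψ y) := rfl

/-- The convex cone generated by the stabilizer states. -/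
noncomputable def stabCone (A : Type) [Fintype A] [DecidableEq A] : Submodule ℝ≥0 (Op A) :=
  Submodule.span ℝ≥0 (pureOp '' stabVec A)

theorem pureOp_mem_stabCone {ψ : Vec A} (h : ψ ∈ stabVec A) : pureOp ψ ∈ stabCone A :=
  Submodule.subset_span ⟨ψ, h, rfl⟩

theorem map_mem_stabCone (f : Op A →ₗ[ℂ] Op B)
    (hf : ∀ ψ ∈ stabVec A, f (pureOp ψ) ∈ stabCone B) {M : Op A} (hM : M ∈ stabCone A) :
    f M ∈ stabCone B := by
  refine Submodule.span_induction (p := fun M _ => f M ∈ stabCone B) ?_ ?_ ?_ ?_ hM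
  · rintro _ ⟨ψ, hψ, rfl⟩
    exact hf ψ hψ
  · simp
  · intro M N _ _ hM hN
    rw [map_add]
    exact add_mem hM hN
  · intro r M _ hM
    rw [LinearMap.map_smul_of_tower]
    exact Submodule.smul_mem _ r hM

theorem conj_zeroState (U : Op A) :
    U * zeroState A * Uᴴ = pureOp (U *ᵥ Pi.single 0 1) := by
  ext x y
  rw [pureOp_apply]
  simp [zeroState, Matrix.mul_apply, Matrix.single_apply, ite_and]

theorem trace_conj_of_clifford {U : Op A} (hU : U ∈ cliffordCircuits A) (M : Op A) :
    (U * M * Uᴴ).trace = M.trace := by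
  rw [Matrix.trace_mul_comm, ← Matrix.mul_assoc, conjTranspose_mul_self_of_clifford hU,
    Matrix.one_mul]

theorem trace_zeroState : (zeroState A).trace = 1 := by
  simp [zeroState, Matrix.trace_single_eq_same]

theorem convex_isStabilizerState : Convex ℝ {ρ : Op A | IsStabilizerState A ρ} :=
  convex_convexHull ℝ _

theorem isStabilizerState_conj {U : Op A} (hU : U ∈ cliffordCircuits A) :
    IsStabilizerState A (U * zeroState A * Uᴴ) :=
  subset_convexHull ℝ _ ⟨U, hU, rfl⟩

/-- A generator has weight `|c|²`, and `t σ + u τ` is `t + u` times a convex combination. -/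
theorem exists_smul_of_mem_stabCone {M : Op A} (hM : M ∈ stabCone A) :
    ∃ (t : ℝ≥0) (σ : Op A), IsStabilizerState A σ ∧ M = t • σ := by
  refine Submodule.span_induction
    (p := fun M _ => ∃ (t : ℝ≥0) (σ : Op A), IsStabilizerState A σ ∧ M = t • σ) ?_ ?_ ?_ ?_ hM
  · rintro _ ⟨_, ⟨c, U, hU, rfl⟩, rfl⟩
    refine ⟨‖c‖₊ ^ 2, _, isStabilizerState_conj hU, ?_⟩
    rw [conj_zeroState]
    ext x y
    have hc : ((‖c‖₊ ^ 2 : ℝ≥0) : ℂ) = c * star c := by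
      have := Complex.mul_conj' c
      rw [Complex.star_def, this]
      simp
    rw [pureOp_apply, Matrix.smul_apply, pureOp_apply, NNReal.smul_def, Complex.real_smul]
    rw [show (((‖c‖₊ ^ 2 : ℝ≥0) : ℝ) : ℂ) = _ from hc]
    simp only [Pi.smul_apply, smul_eq_mul, star_mul']
    ring
  · exact ⟨0, _, isStabilizerState_conj (one_mem _), by simp⟩
  · rintro _ _ _ _ ⟨t, σ, hσ, rfl⟩ ⟨u, τ, hτ, rfl⟩
    -- Zero total weight is separated because the convex weights divide by `t + u`.
    by_cases h : t + u = 0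
    · obtain ⟨rfl, rfl⟩ := add_eq_zero.mp h
      exact ⟨0, σ, hσ, by simp⟩
    · refine ⟨t + u, (t / (t + u)) • σ + (u / (t + u)) • τ,
        convex_isStabilizerState hσ hτ (t / (t + u)).coe_nonneg (u / (t + u)).coe_nonneg ?_, ?_⟩
      · norm_cast
        rw [← add_div, div_self h]
      · rw [smul_add, smul_smul, smul_smul, mul_div_cancel₀ _ h, mul_div_cancel₀ _ h]
  · rintro r _ _ ⟨t, σ, hσ, rfl⟩
    exact ⟨r * t, σ, hσ, by rw [smul_smul]⟩

theorem trace_of_isStabilizerState {ρ : Op A} (h : IsStabilizerState A ρ) : ρ.trace = 1 := by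
  have hc : Convex ℝ {σ : Op A | σ.trace = 1} := by
    intro σ hσ τ hτ a b _ _ hab
    simp only [Set.mem_ofPred_eq] at hσ hτ ⊢
    rw [Matrix.trace_add, Matrix.trace_smul, Matrix.trace_smul, hσ, hτ, ← add_smul, hab, one_smul]
  refine convexHull_min ?_ hc h
  rintro _ ⟨U, hU, rfl⟩
  exact (trace_conj_of_clifford hU _).trans trace_zeroState

theorem mem_stabCone_of_isStabilizerState {ρ : Op A} (h : IsStabilizerState A ρ) :
    ρ ∈ stabCone A := by
  have hc : Convex ℝ (stabCone A : Set (Op A)) := by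
    intro σ hσ τ hτ a b ha hb _
    exact add_mem (Submodule.smul_mem _ (⟨a, ha⟩ : ℝ≥0) hσ)
      (Submodule.smul_mem _ (⟨b, hb⟩ : ℝ≥0) hτ)
  refine convexHull_min ?_ hc h
  rintro _ ⟨U, hU, rfl⟩
  rw [conj_zeroState]
  exact pureOp_mem_stabCone (mulVec_mem_stabVec hU zero_ket_mem)

/-- Stabilizer states are the normalized elements of the stabilizer cone. -/
theorem isStabilizerState_iff {ρ : Op A} :
    IsStabilizerState A ρ ↔ ρ ∈ stabCone A ∧ ρ.trace = 1 := by
  refine ⟨fun h => ⟨mem_stabCone_of_isStabilizerState h, trace_of_isStabilizerState h⟩, ?_⟩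
  rintro ⟨h, ht⟩
  obtain ⟨t, σ, hσ, rfl⟩ := exists_smul_of_mem_stabCone h
  rw [Matrix.trace_smul, trace_of_isStabilizerState hσ, NNReal.smul_def, Complex.real_smul,
    mul_one] at ht
  have : t = 1 := by exact_mod_cast ht
  rwa [this, one_smul]

/-- The block `⟨s|M|s⟩` of an operator. -/
def slice (s : R → Fin 2) : Op (B ⊕ R) →ₗ[ℂ] Op B where
  toFun M := Matrix.of fun x y => M (Sum.elim x s) (Sum.elim y s)
  map_add' _ _ := rfl
  map_smul' _ _ := rfl

theorem slice_mem_stabCone (s : R → Fin 2) {M : Op (B ⊕ R)} (h : M ∈ stabCone (B ⊕ R)) :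
    slice s M ∈ stabCone B :=
  map_mem_stabCone (slice s) (fun _ hψ => pureOp_mem_stabCone (slice_mem_stabVec hψ s)) h

theorem relabel_mem_stabCone (e : A ≃ B) {M : Op A} (h : M ∈ stabCone A) :
    relabel e M ∈ stabCone B :=
  map_mem_stabCone (relabel e) (fun _ hψ => pureOp_mem_stabCone (relabel_mem_stabVec e hψ)) h

theorem conjMap_pureOp (U : Op A) (ψ : Vec A) : conjMap U (pureOp ψ) = pureOp (U *ᵥ ψ) := by
  simp only [conjMap, pureOp, LinearMap.comp_apply, LinearMap.mulLeft_apply,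
    LinearMap.mulRight_apply, Matrix.mul_vecMulVec, Matrix.vecMulVec_mul, Matrix.star_mulVec]

theorem conjMap_mem_stabCone {U : Op A} (hU : U ∈ cliffordCircuits A) {M : Op A}
    (h : M ∈ stabCone A) : conjMap U M ∈ stabCone A :=
  map_mem_stabCone (conjMap U) (fun ψ hψ => by
    rw [conjMap_pureOp]
    exact pureOp_mem_stabCone (mulVec_mem_stabVec hU hψ)) h

/-- The tensor product as a bilinear map. -/
noncomputable def tensorBilin : Op A →ₗ[ℂ] Op B →ₗ[ℂ] Op (A ⊕ B) :=
  LinearMap.mk₂ ℂ tensor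
    (fun _ _ _ => by ext; simp [tensor, add_mul])
    (fun _ _ _ => by ext; simp [tensor, mul_assoc])
    (fun _ _ _ => by ext; simp [tensor, mul_add])
    (fun _ _ _ => by ext; simp [tensor, mul_left_comm])

theorem bilin_mem_stabCone {C : Type} [Fintype C] [DecidableEq C]
    (f : Op A →ₗ[ℂ] Op B →ₗ[ℂ] Op C)
    (hf : ∀ ψ ∈ stabVec A, ∀ φ ∈ stabVec B, f (pureOp ψ) (pureOp φ) ∈ stabCone C)
    {M : Op A} {N : Op B} (hM : M ∈ stabCone A) (hN : N ∈ stabCone B) :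
    f M N ∈ stabCone C :=
  map_mem_stabCone (f.flip N)
    (fun ψ hψ => map_mem_stabCone (f (pureOp ψ)) (fun φ hφ => hf ψ hψ φ hφ) hN) hM

theorem tensor_mem_stabCone {M : Op A} {N : Op B} (hM : M ∈ stabCone A) (hN : N ∈ stabCone B) :
    tensor M N ∈ stabCone (A ⊕ B) := by
  refine bilin_mem_stabCone tensorBilin (fun ψ hψ φ hφ => ?_) hM hN
  convert pureOp_mem_stabCone (tensorVec_mem_stabVec hψ hφ) using 1
  ext x y
  simp [tensorBilin, tensor, pureOp_apply, tensorVec]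
  ring

/-- Contraction of the common register of two operators. -/
noncomputable def contract : Op (B ⊕ A) →ₗ[ℂ] Op (A ⊕ R) →ₗ[ℂ] Op (B ⊕ R) :=
  LinearMap.mk₂ ℂ (fun μ ρ => Matrix.of fun x y => ∑ a, ∑ a',
      μ (Sum.elim (fun b => x (Sum.inl b)) a) (Sum.elim (fun b => y (Sum.inl b)) a') *
        ρ (Sum.elim a fun r => x (Sum.inr r)) (Sum.elim a' fun r => y (Sum.inr r)))
    (fun _ _ _ => by ext; simp [add_mul, Finset.sum_add_distrib])
    (fun _ _ _ => by ext; simp [mul_assoc, Finset.mul_sum])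
    (fun _ _ _ => by ext; simp [mul_add, Finset.sum_add_distrib])
    (fun _ _ _ => by ext; simp [mul_left_comm, Finset.mul_sum])

omit [Fintype B] [DecidableEq B] [Fintype R] [DecidableEq R] in
theorem contract_apply (μ : Op (B ⊕ A)) (ρ : Op (A ⊕ R)) (x y : B ⊕ R → Fin 2) :
    contract μ ρ x y = ∑ a, ∑ a',
      μ (Sum.elim (fun b => x (Sum.inl b)) a) (Sum.elim (fun b => y (Sum.inl b)) a') *
        ρ (Sum.elim a fun r => x (Sum.inr r)) (Sum.elim a' fun r => y (Sum.inr r)) := rfl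

/-- Contraction is bilinear, and contracting `|ψ⟩⟨ψ|` with `|φ⟩⟨φ|` gives the pure operator of the
contracted vector. -/
theorem contract_mem_stabCone {μ : Op (B ⊕ A)} {ρ : Op (A ⊕ R)} (hμ : μ ∈ stabCone (B ⊕ A))
    (hρ : ρ ∈ stabCone (A ⊕ R)) : contract μ ρ ∈ stabCone (B ⊕ R) := by
  refine bilin_mem_stabCone contract (fun ψ hψ φ hφ => ?_) hμ hρ
  convert pureOp_mem_stabCone (contract_mem_stabVec hψ hφ) using 1
  ext x y
  simp only [contract_apply, pureOp_apply, star_sum, Finset.sum_mul_sum, star_mul']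
  exact Finset.sum_congr rfl fun a _ => Finset.sum_congr rfl fun a' _ => by ring

theorem posSemidef_of_mem_stabCone {M : Op A} (h : M ∈ stabCone A) : M.PosSemidef := by
  refine Submodule.span_induction (p := fun M _ => M.PosSemidef) ?_ ?_ ?_ ?_ h
  · rintro _ ⟨ψ, _, rfl⟩
    exact Matrix.posSemidef_vecMulVec_self_star ψ
  · exact .zero
  · exact fun _ _ _ _ hM hN => hM.add hN
  · exact fun r _ _ hM => hM.smul r.2

end Cone

/-! ### Parallel composition of linear maps -/

section TensorMap

variable {A B C D R : Type} [Fintype A] [DecidableEq A] [Fintype B] [DecidableEq B]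
  [Fintype C] [DecidableEq C] [Fintype D] [DecidableEq D] [Fintype R] [DecidableEq R]

omit [Fintype B] [DecidableEq B] in
theorem apply_eq_sum (E : Op A →ₗ[ℂ] Op B) (M : Op A) (x y : B → Fin 2) :
    E M x y = ∑ a, ∑ a', M a a' * E (Matrix.single a a' 1) x y := by
  conv_lhs => rw [Matrix.matrix_eq_sum_single M]
  simp only [map_sum, Matrix.sum_apply]
  refine Finset.sum_congr rfl fun a _ => Finset.sum_congr rfl fun a' _ => ?_
  rw [← mul_one (M a a'), ← smul_eq_mul, ← Matrix.smul_single, map_smul, Matrix.smul_apply,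
    smul_eq_mul, smul_eq_mul, mul_one]

/-- The block of an operator on `A ⊕ R` with given row and column labels on `R`. -/
def block (M : Op (A ⊕ R)) (r r' : R → Fin 2) : Op A :=
  Matrix.of fun a a' => M (Sum.elim a r) (Sum.elim a' r')

-- Replaces the fourfold sum over matrix units by one application of `E` to a block; all later
-- identities for `E ⊗ id` rest on this.
omit [Fintype B] [DecidableEq B] in
theorem tensorMap_id_apply (E : Op A →ₗ[ℂ] Op B) (M : Op (A ⊕ R)) (x y : B ⊕ R → Fin 2) :
    tensorMap E (LinearMap.id : Op R →ₗ[ℂ] Op R) M x y =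
      E (block M (fun r => x (Sum.inr r)) (fun r => y (Sum.inr r)))
        (fun b => x (Sum.inl b)) (fun b => y (Sum.inl b)) := by
  rw [apply_eq_sum E]
  simp only [tensorMap, LinearMap.coe_mk, AddHom.coe_mk, Matrix.sum_apply, Matrix.smul_apply,
    LinearMap.id_apply, tensor, Matrix.of_apply, smul_eq_mul]
  refine Finset.sum_congr rfl fun a _ => ?_
  refine Finset.sum_congr rfl fun a' _ => ?_
  generalize E (Matrix.single a a' 1) _ _ = w
  rw [Finset.sum_eq_single fun r => x (Sum.inr r), Finset.sum_eq_single fun r => y (Sum.inr r)]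
  · rw [Matrix.single_apply_same, mul_one]
    rfl
  · intro c' _ hc'
    rw [Matrix.single_apply_of_ne _ _ _ _ _ fun h => hc' h.2, mul_zero, mul_zero]
  · exact fun h => absurd (Finset.mem_univ _) h
  · intro c _ hc
    refine Finset.sum_eq_zero fun c' _ => ?_
    rw [Matrix.single_apply_of_ne _ _ _ _ _ fun h => hc h.1, mul_zero, mul_zero]
  · exact fun h => absurd (Finset.mem_univ _) h

omit [Fintype B] [DecidableEq B] in
theorem block_tensorMap_id (E : Op A →ₗ[ℂ] Op B) (M : Op (A ⊕ R)) (r r' : R → Fin 2) :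
    block (tensorMap E (LinearMap.id : Op R →ₗ[ℂ] Op R) M) r r' = E (block M r r') :=
  Matrix.ext fun _ _ => tensorMap_id_apply E M _ _

omit [Fintype A] [DecidableEq A] [Fintype B] [DecidableEq B] in
theorem relabel_apply (e : A ≃ B) (M : Op A) (x y : B → Fin 2) :
    relabel e M x y = M (fun a => x (e a)) (fun a => y (e a)) := rfl

omit [Fintype A] [DecidableEq A] [Fintype C] [DecidableEq C] in
theorem relabel_sumComm_tensor (ρ : Op A) (σ : Op C) :
    relabel (Equiv.sumComm A C) (tensor ρ σ) = tensor σ ρ :=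
  Matrix.ext fun _ _ => mul_comm _ _

omit [Fintype B] [DecidableEq B] [Fintype D] [DecidableEq D] in
theorem tensorMap_tensor (E : Op A →ₗ[ℂ] Op B) (F : Op C →ₗ[ℂ] Op D) (ρ : Op A) (σ : Op C) :
    tensorMap E F (tensor ρ σ) = tensor (E ρ) (F σ) := by
  ext x y
  simp only [tensorMap, LinearMap.coe_mk, AddHom.coe_mk, Matrix.sum_apply, Matrix.smul_apply,
    tensor_elim, smul_eq_mul]
  simp only [tensor, Matrix.of_apply]
  rw [apply_eq_sum E, apply_eq_sum F, Finset.sum_mul]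
  refine Finset.sum_congr rfl fun a _ => ?_
  rw [Finset.sum_mul]
  refine Finset.sum_congr rfl fun a' _ => ?_
  rw [Finset.mul_sum]
  refine Finset.sum_congr rfl fun c _ => ?_
  rw [Finset.mul_sum]
  exact Finset.sum_congr rfl fun c' _ => by ring

-- Matrix units of a composite register are tensor products of matrix units, so product operators
-- span.
omit [DecidableEq A] [DecidableEq C] in
theorem op_linearMap_ext {W : Type*} [AddCommMonoid W] [Module ℂ W]
    {f g : Op (A ⊕ C) →ₗ[ℂ] W} (h : ∀ ρ σ, f (tensor ρ σ) = g (tensor ρ σ)) : f = g := by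
  refine Matrix.ext_linearMap ℂ fun p q => LinearMap.ext_ring ?_
  have : (Matrix.single p q 1 : Op (A ⊕ C)) =
      tensor (Matrix.single (p ∘ Sum.inl) (q ∘ Sum.inl) 1)
        (Matrix.single (p ∘ Sum.inr) (q ∘ Sum.inr) 1) := by
    ext x y
    obtain ⟨⟨a, c⟩, rfl⟩ := (Equiv.sumArrowEquivProdArrow A C (Fin 2)).symm.surjective p
    obtain ⟨⟨a', c'⟩, rfl⟩ := (Equiv.sumArrowEquivProdArrow A C (Fin 2)).symm.surjective q
    rw [← Sum.elim_comp_inl_inr x, ← Sum.elim_comp_inl_inr y, tensor_elim]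
    simp only [Equiv.sumArrowEquivProdArrow, Equiv.coe_fn_symm_mk, Matrix.single_apply,
      Sum.elim_eq_iff, Sum.elim_comp_inl, Sum.elim_comp_inr, mul_ite, mul_one, mul_zero]
    split_ifs <;> first | rfl | (exfalso; tauto)
  simp only [LinearMap.comp_apply, Matrix.singleLinearMap_apply, this]
  exact h _ _

-- `E ⊗ F = (E ⊗ id)(id ⊗ F)`, with `id ⊗ F` expressed by swaps, so only ancillas on the right need
-- be considered.
omit [Fintype B] [DecidableEq B] in
theorem tensorMap_eq_comp (E : Op A →ₗ[ℂ] Op B) (F : Op C →ₗ[ℂ] Op D) :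
    tensorMap E F = tensorMap E LinearMap.id ∘ₗ relabel (Equiv.sumComm D A) ∘ₗ
      tensorMap F LinearMap.id ∘ₗ relabel (Equiv.sumComm A C) :=
  op_linearMap_ext fun ρ σ => by
    simp only [LinearMap.comp_apply, relabel_sumComm_tensor, tensorMap_tensor, LinearMap.id_apply]

theorem trace_tensor (ρ : Op A) (σ : Op B) : (tensor ρ σ).trace = ρ.trace * σ.trace := by
  simp [Matrix.trace, sum_elim, Finset.sum_mul_sum]

theorem trace_tensorMap (E : Op A →ₗ[ℂ] Op B) (F : Op C →ₗ[ℂ] Op D)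
    (hE : ∀ M, (E M).trace = M.trace) (hF : ∀ M, (F M).trace = M.trace) (M : Op (A ⊕ C)) :
    (tensorMap E F M).trace = M.trace := by
  have : Matrix.traceLinearMap _ ℂ ℂ ∘ₗ tensorMap E F = Matrix.traceLinearMap _ ℂ ℂ :=
    op_linearMap_ext fun ρ σ => by simp [tensorMap_tensor, trace_tensor, hE, hF]
  exact LinearMap.congr_fun this M

theorem tensor_mul_tensor (ρ ρ' : Op A) (σ σ' : Op C) :
    tensor ρ σ * tensor ρ' σ' = tensor (ρ * ρ') (σ * σ') := by
  ext x y
  rw [Matrix.mul_apply, sum_elim]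
  simp only [tensor, Matrix.of_apply, Matrix.mul_apply, Finset.sum_mul_sum, Sum.elim_inl,
    Sum.elim_inr]
  exact Finset.sum_congr rfl fun a _ => Finset.sum_congr rfl fun c _ => by ring

/-! ### Maps that completely preserve a class of operators -/

/-- `E` preserves the class `Q` even when it acts on a part of a larger register. -/
def Preserves (Q : OpClass) (E : Op A →ₗ[ℂ] Op B) : Prop :=
  ∀ (R : Type) [Fintype R] [DecidableEq R] (M : Op (A ⊕ R)),
    Q (A ⊕ R) M → Q (B ⊕ R) (tensorMap E (LinearMap.id : Op R →ₗ[ℂ] Op R) M)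

/-- A class of operators that does not depend on the names of the qubits. -/
def RelabelInvariant (Q : OpClass) : Prop :=
  ∀ {A B : Type} [Fintype A] [DecidableEq A] [Fintype B] [DecidableEq B] (e : A ≃ B) (M : Op A),
    Q A M → Q B (relabel e M)

variable {Q : OpClass}

theorem Preserves.comp {E : Op A →ₗ[ℂ] Op B} {F : Op B →ₗ[ℂ] Op C} (hF : Preserves Q F)
    (hE : Preserves Q E) : Preserves Q (F ∘ₗ E) := by
  intro R _ _ M hM
  convert hF R _ (hE R M hM) using 1
  ext x y
  simp only [tensorMap_id_apply, LinearMap.comp_apply, block_tensorMap_id]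

theorem preserves_relabel (hQ : RelabelInvariant Q) (e : A ≃ B) : Preserves Q (relabel e) := by
  intro R _ _ M hM
  convert hQ (e.sumCongr (Equiv.refl R)) M hM using 1
  ext x y
  rw [tensorMap_id_apply]
  refine congrArg₂ M (funext ?_) (funext ?_) <;> rintro (_ | _) <;> rfl

omit [Fintype A] [DecidableEq A] in
theorem relabel_refl : relabel (Equiv.refl A) = LinearMap.id := rfl

theorem preserves_id (hQ : RelabelInvariant Q) : Preserves Q (LinearMap.id : Op A →ₗ[ℂ] Op A) := by
  rw [← relabel_refl]
  exact preserves_relabel hQ _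

/-- The idle register `C` is absorbed into the ancilla: up to reassociation, `(E ⊗ id_C) ⊗ id_R` is
`E ⊗ id_{C ⊕ R}`. -/
theorem preserves_tensorMap_id (hQ : RelabelInvariant Q) {E : Op A →ₗ[ℂ] Op B}
    (hE : Preserves Q E) : Preserves Q (tensorMap E (LinearMap.id : Op C →ₗ[ℂ] Op C)) := by
  intro R _ _ M hM
  convert hQ (Equiv.sumAssoc B C R).symm _ (hE (C ⊕ R) _ (hQ (Equiv.sumAssoc A C R) M hM))
    using 1
  ext x y
  simp only [relabel_apply, tensorMap_id_apply]
  refine congrArg (fun N : Op A => E N _ _) (Matrix.ext fun a a' => ?_)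
  refine congrArg₂ M (funext ?_) (funext ?_) <;> rintro ((_ | _) | _) <;> rfl

theorem preserves_tensorMap (hQ : RelabelInvariant Q) {E : Op A →ₗ[ℂ] Op B}
    {F : Op C →ₗ[ℂ] Op D} (hE : Preserves Q E) (hF : Preserves Q F) :
    Preserves Q (tensorMap E F) := by
  rw [tensorMap_eq_comp]
  exact (preserves_tensorMap_id hQ hE).comp ((preserves_relabel hQ _).comp
    ((preserves_tensorMap_id hQ hF).comp (preserves_relabel hQ _)))

/-- The closure properties of a class of operators that make stabilizer operations preserve it. -/
structure StabilizerClosed (Q : OpClass) : Prop where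
  relabel : RelabelInvariant Q
  add : ∀ {A : Type} [Fintype A] [DecidableEq A] (M N : Op A), Q A M → Q A N → Q A (M + N)
  zero : ∀ {A : Type} [Fintype A] [DecidableEq A], Q A 0
  smul : ∀ {A : Type} [Fintype A] [DecidableEq A] (r : ℝ) (M : Op A), 0 ≤ r → Q A M →
    Q A ((r : ℂ) • M)
  conj : ∀ {A : Type} [Fintype A] [DecidableEq A] (U : Op A), U ∈ cliffordCircuits A →
    ∀ M, Q A M → Q A (conjMap U M)
  attach : ∀ {A B : Type} [Fintype A] [DecidableEq A] [Fintype B] [DecidableEq B] (ρ : Op A)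
    (M : Op B), IsStabilizerState A ρ → Q B M → Q (A ⊕ B) (tensor ρ M)
  slice : ∀ {B R : Type} [Fintype B] [DecidableEq B] [Fintype R] [DecidableEq R]
    (s : R → Fin 2) (M : Op (B ⊕ R)), Q (B ⊕ R) M → Q B (slice s M)

theorem stabilizerClosed_stabCone : StabilizerClosed fun A _ _ M => M ∈ stabCone A where
  relabel e _ h := relabel_mem_stabCone e h
  add _ _ h h' := add_mem h h'
  zero := zero_mem _
  smul r _ hr h := Submodule.smul_mem _ (⟨r, hr⟩ : ℝ≥0) h
  conj _ hU _ h := conjMap_mem_stabCone hU h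
  attach _ _ hρ h := tensor_mem_stabCone (mem_stabCone_of_isStabilizerState hρ) h
  slice s _ h := slice_mem_stabCone s h

omit [DecidableEq A] [DecidableEq B] in
theorem posSemidef_tensor {ρ : Op A} {σ : Op B} (hρ : ρ.PosSemidef) (hσ : σ.PosSemidef) :
    (tensor ρ σ).PosSemidef :=
  (hρ.kronecker hσ).submatrix fun x : A ⊕ B → Fin 2 =>
    ((fun a => x (Sum.inl a)), (fun b => x (Sum.inr b)))

/-- For this class, `Preserves` is exactly the complete positivity clause of `IsChannel`. -/
theorem stabilizerClosed_posSemidef : StabilizerClosed fun _ _ _ M => M.PosSemidef where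
  relabel {_ B} _ _ _ _ e _ h := Matrix.PosSemidef.submatrix h fun (x : B → Fin 2) a => x (e a)
  add _ _ h h' := h.add h'
  zero := .zero
  smul _ _ hr h := h.smul (Complex.zero_le_real.mpr hr)
  conj U _ _ h := h.mul_mul_conjTranspose_same U
  attach _ _ hρ h :=
    posSemidef_tensor (posSemidef_of_mem_stabCone (mem_stabCone_of_isStabilizerState hρ)) h
  slice s _ h := h.submatrix fun x => Sum.elim x s

namespace StabilizerClosed

/-- A Clifford circuit on part of a register is a Clifford circuit on the whole; the swaps bring the
acted-on part to the right, where `tensor 1 U` applies. -/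
theorem preserves_conjMap (hQ : StabilizerClosed Q) {U : Op A} (hU : U ∈ cliffordCircuits A) :
    Preserves Q (conjMap U) := by
  intro R _ _ M hM
  convert hQ.relabel (Equiv.sumComm R A) _ (hQ.conj _ (tensor_one_mem_cliffordCircuits (A := R) hU)
    _ (hQ.relabel (Equiv.sumComm A R) _ hM)) using 1
  refine LinearMap.congr_fun (f := tensorMap (conjMap U) LinearMap.id)
    (g := MagicCDRT.relabel (Equiv.sumComm R A) ∘ₗ conjMap (tensor 1 U) ∘ₗ MagicCDRT.relabel (Equiv.sumComm A R))
    (op_linearMap_ext fun ρ σ => ?_) M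
  have h2 : (tensor (1 : Op R) U)ᴴ = tensor (1 : Op R) Uᴴ := by
    ext x y
    simp only [tensor, Matrix.conjTranspose_apply, Matrix.of_apply, star_mul']
    rw [← Matrix.conjTranspose_apply, Matrix.conjTranspose_one]
  simp only [LinearMap.comp_apply, relabel_sumComm_tensor, tensorMap_tensor, LinearMap.id_apply,
    conjMap, LinearMap.mulLeft_apply, LinearMap.mulRight_apply, h2, tensor_mul_tensor,
    Matrix.one_mul, Matrix.mul_one]

theorem preserves_prepareMap (hQ : StabilizerClosed Q) {ρ : Op A} (hρ : IsStabilizerState A ρ) :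
    Preserves Q (prepareMap ρ) := by
  intro R _ _ M hM
  convert hQ.attach ρ _ hρ (hQ.relabel (Equiv.emptySum Empty R) _ hM) using 1
  ext x y
  rw [tensorMap_id_apply]
  simp only [prepareMap, LinearMap.coe_mk, AddHom.coe_mk, tensor, Matrix.of_apply,
    Matrix.smul_apply, smul_eq_mul, Matrix.trace, Finset.univ_unique, Finset.sum_singleton,
    Matrix.diag_apply, block]
  rw [mul_comm]
  congr 2 <;> (ext (a | _); exacts [a.elim, rfl])

theorem preserves_attachZero (hQ : StabilizerClosed Q) : Preserves Q (attachZero A) := by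
  intro R _ _ M hM
  have h0 : IsStabilizerState Unit (zeroState Unit) := by
    simpa using isStabilizerState_conj (one_mem (cliffordCircuits Unit))
  convert hQ.relabel (Equiv.sumAssoc Unit A R).symm _ (hQ.attach _ M h0 hM) using 1
  ext x y
  rw [tensorMap_id_apply]
  simp only [attachZero, LinearMap.coe_mk, AddHom.coe_mk, tensor, Matrix.of_apply, block]
  congr 2 <;> (ext (_ | _) <;> rfl)

theorem preserves_branch (hQ : StabilizerClosed Q) (b : Fin 2) : Preserves Q (branch A b) := by
  intro R _ _ M hM
  convert hQ.slice (fun _ => b) _ (hQ.relabel (Equiv.sumComm Unit (A ⊕ R)) _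
    (hQ.relabel (Equiv.sumAssoc Unit A R) _ hM)) using 1
  ext x y
  rw [tensorMap_id_apply]
  refine congrArg₂ M (funext ?_) (funext ?_) <;> rintro ((_ | _) | _) <;> rfl

theorem sum_mem (hQ : StabilizerClosed Q) {ι : Type*} (s : Finset ι) (f : ι → Op A)
    (h : ∀ i ∈ s, Q A (f i)) : Q A (∑ i ∈ s, f i) :=
  Finset.sum_induction f (Q A) hQ.add hQ.zero h

theorem preserves_add (hQ : StabilizerClosed Q) {E F : Op A →ₗ[ℂ] Op B} (hE : Preserves Q E)
    (hF : Preserves Q F) : Preserves Q (E + F) := by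
  intro R _ _ M hM
  convert hQ.add _ _ (hE R M hM) (hF R M hM) using 1
  ext x y
  simp [tensorMap_id_apply]

theorem preserves_smul (hQ : StabilizerClosed Q) {E : Op A →ₗ[ℂ] Op B} {r : ℝ} (hr : 0 ≤ r)
    (hE : Preserves Q E) : Preserves Q ((r : ℂ) • E) := by
  intro R _ _ M hM
  convert hQ.smul r _ hr (hE R M hM) using 1
  ext x y
  simp [tensorMap_id_apply]

/-- The partial trace is the sum of the slices over all basis states of the discarded register. -/
theorem preserves_discard (hQ : StabilizerClosed Q) : Preserves Q (discard A) := by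
  intro R _ _ M hM
  convert hQ.relabel (Equiv.emptySum Empty R).symm _ (hQ.sum_mem Finset.univ _
    fun (s : A → Fin 2) _ => hQ.slice s _ (hQ.relabel (Equiv.sumComm A R) _ hM)) using 1
  ext x y
  rw [tensorMap_id_apply, relabel_apply, Matrix.sum_apply]
  refine Finset.sum_congr rfl fun a _ => ?_
  refine congrArg₂ M (funext ?_) (funext ?_) <;> rintro (_ | _) <;> rfl

end StabilizerClosed

end TensorMap

/-! ### Choi matrices, the link product and the Bell measurement -/

section Choi

variable {A B R : Type} [Fintype A] [DecidableEq A] [Fintype B] [DecidableEq B]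
  [Fintype R] [DecidableEq R]

omit [DecidableEq A] in
theorem dim_ne_zero : dim A ≠ 0 := pow_ne_zero _ two_ne_zero

omit [DecidableEq A] in
theorem dim_eq_ofReal : dim A = ((2 ^ Fintype.card A : ℝ) : ℂ) := by simp [dim]

theorem choiState_elim (x y x' y' : A → Fin 2) :
    choiState A (Sum.elim x y) (Sum.elim x' y') = if x = y ∧ x' = y' then 1 else 0 := by
  have h : ∀ a b : A → Fin 2, (Matrix.single a b (1 : ℂ)) x x' * (Matrix.single a b (1 : ℂ)) y y' =
      if a = x then (if b = x' then (if x = y ∧ x' = y' then 1 else 0) else 0) else 0 := by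
    intro a b
    by_cases ha : a = x <;> by_cases hb : b = x'
    · subst ha hb
      simp [Matrix.single_apply]
    all_goals simp [Matrix.single_apply, ha, hb]
  simp only [choiState, Matrix.sum_apply, tensor_elim, h, Finset.sum_ite_eq', Finset.mem_univ,
    if_true, Finset.sum_ite_irrel, Finset.sum_const_zero]

omit [Fintype A] [DecidableEq A] [Fintype B] [DecidableEq B] in
theorem op_ext_elim {M N : Op (A ⊕ B)} (h : ∀ x y x' y',
    M (Sum.elim x y) (Sum.elim x' y') = N (Sum.elim x y) (Sum.elim x' y')) : M = N := by
  ext p q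
  rw [← Sum.elim_comp_inl_inr p, ← Sum.elim_comp_inl_inr q]
  exact h _ _ _ _

theorem sqrt_two_inv_pow_mul_self (n : ℕ) :
    (((Real.sqrt 2 : ℝ) : ℂ)⁻¹) ^ n * (((Real.sqrt 2 : ℝ) : ℂ)⁻¹) ^ n = ((2 : ℂ) ^ n)⁻¹ := by
  rw [← mul_pow, ← mul_inv, sqrt_two_sq, inv_pow]

theorem star_sqrt_two_inv_pow (n : ℕ) :
    star ((((Real.sqrt 2 : ℝ) : ℂ)⁻¹) ^ n) = (((Real.sqrt 2 : ℝ) : ℂ)⁻¹) ^ n := by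
  simp [Complex.conj_ofReal]

theorem pureOp_bellVector_zero :
    pureOp (bellVector (0 : A ⊕ A → Fin 2)) = (dim A)⁻¹ • choiState A := by
  refine op_ext_elim fun x y x' y' => ?_
  rw [pureOp_apply, Matrix.smul_apply, choiState_elim, bellVector_zero_elim, bellVector_zero_elim]
  by_cases h : x = y <;> by_cases h' : x' = y' <;>
    simp only [h, h', if_true, if_false, and_true, and_false, star_zero, zero_mul,
      mul_zero, star_sqrt_two_inv_pow, sqrt_two_inv_pow_mul_self, smul_eq_mul, mul_one]
  rfl

/-- The inverse Bell circuit prepares the Bell vector from `|0…0⟩`. -/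
theorem isStabilizerState_choiState : IsStabilizerState (A ⊕ A) ((dim A)⁻¹ • choiState A) := by
  obtain ⟨U, hU, e⟩ := exists_bell_circuit A
  have hU' := hadamardCnotCircuits_le hU
  have h := isStabilizerState_conj (conjTranspose_mem_cliffordCircuits hU')
  rwa [conj_zeroState, ← e 0, Matrix.mulVec_mulVec, conjTranspose_mul_self_of_clifford hU',
    Matrix.one_mulVec, pureOp_bellVector_zero] at h

theorem block_choiState (a a' : A → Fin 2) : block (choiState A) a a' = Matrix.single a a' 1 := by
  ext x x'
  simp only [block, Matrix.of_apply, choiState_elim, Matrix.single_apply, eq_comm]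

omit [Fintype B] [DecidableEq B] in
theorem choi_elim (E : Op A →ₗ[ℂ] Op B) (b b' : B → Fin 2) (a a' : A → Fin 2) :
    choi E (Sum.elim b a) (Sum.elim b' a') = E (Matrix.single a a' 1) b b' := by
  rw [choi, tensorMap_id_apply]
  simp only [Sum.elim_inr, Sum.elim_inl, block_choiState]

-- The blocks of the Choi matrix are the values of `E` on matrix units, so contracting with it
-- reproduces `E`, ancilla included.
omit [Fintype B] [DecidableEq B] in
theorem tensorMap_id_eq_contract (E : Op A →ₗ[ℂ] Op B) (ρ : Op (A ⊕ R)) :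
    tensorMap E LinearMap.id ρ = contract (choi E) ρ := by
  ext x y
  rw [tensorMap_id_apply, apply_eq_sum E, contract_apply]
  simp only [choi_elim, block, Matrix.of_apply]
  exact Finset.sum_congr rfl fun a _ => Finset.sum_congr rfl fun a' _ => mul_comm _ _

omit [Fintype B] [DecidableEq B] in
theorem renormChoi_eq (E : Op A →ₗ[ℂ] Op B) :
    renormChoi E = tensorMap E LinearMap.id ((dim A)⁻¹ • choiState A) := by
  rw [map_smul]; rfl

/-- The cone ignores the factor `d_A` between the Choi matrix and its renormalization, so
contraction keeps the output in the cone; trace preservation supplies the normalization. -/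
theorem crngOps_of_cdOps {E : Op A →ₗ[ℂ] Op B} (h : CDOps IsStabilizerState A B E) :
    CRNGOps IsStabilizerState A B E := by
  refine ⟨h.1, fun R _ _ ρ hρ => ?_⟩
  rw [isStabilizerState_iff] at hρ ⊢
  refine ⟨?_, by rw [trace_tensorMap _ _ h.1.2 fun _ => rfl, hρ.2]⟩
  rw [tensorMap_id_eq_contract]
  refine contract_mem_stabCone ?_ hρ.1
  have := stabilizerClosed_stabCone.smul (2 ^ Fintype.card A) _ (by positivity)
    (mem_stabCone_of_isStabilizerState h.2)
  rwa [← dim_eq_ofReal, renormChoi, smul_smul, mul_inv_cancel₀ dim_ne_zero, one_smul] at this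

theorem cdOps_iff_crngOps {E : Op A →ₗ[ℂ] Op B} :
    CDOps IsStabilizerState A B E ↔ CRNGOps IsStabilizerState A B E := by
  refine ⟨crngOps_of_cdOps, fun h => ⟨h.1, ?_⟩⟩
  rw [renormChoi_eq]
  exact h.2 A _ isStabilizerState_choiState

/-- The hypothesis is used for two classes: positive semidefinite operators make `E` a channel, the
stabilizer cone makes it stabilizer-preserving. -/
theorem crngOps_of_preserves {E : Op A →ₗ[ℂ] Op B} (htr : ∀ M, (E M).trace = M.trace)
    (h : ∀ Q : OpClass, StabilizerClosed Q → Preserves Q E) :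
    CRNGOps IsStabilizerState A B E := by
  refine ⟨⟨h _ stabilizerClosed_posSemidef, htr⟩, fun R _ _ ρ hρ => ?_⟩
  rw [isStabilizerState_iff] at hρ ⊢
  exact ⟨h _ stabilizerClosed_stabCone R ρ hρ.1, by
    rw [trace_tensorMap _ _ htr fun _ => rfl, hρ.2]⟩

/-! ### The link product and its realization by a Bell measurement -/

omit [Fintype A] [DecidableEq A] [Fintype B] [DecidableEq B] in
theorem pairOp_elim (μ : Op (B ⊕ A)) (ρ : Op A) (x y : B → Fin 2) (a a' c c' : A → Fin 2) :
    pairOp μ ρ (Sum.elim x (Sum.elim a c)) (Sum.elim y (Sum.elim a' c')) =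
      μ (Sum.elim x a) (Sum.elim y a') * ρ c c' := by
  simp only [pairOp, relabel_apply, tensor, Matrix.of_apply]
  refine congrArg₂ _ (congrArg₂ μ (funext ?_) (funext ?_)) rfl <;> rintro (_ | _) <;> rfl

theorem link_apply (μ : Op (B ⊕ A)) (ρ : Op A) (x y : B → Fin 2) :
    link μ ρ x y = ∑ a, ∑ a', μ (Sum.elim x a) (Sum.elim y a') * ρ a a' := by
  simp only [link, ptraceRight, Matrix.of_apply, Matrix.mul_apply, sum_elim, tensor_elim,
    choiState_elim, pairOp_elim, Matrix.one_apply, ite_and, mul_ite, mul_one, mul_zero, ite_mul,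
    one_mul, zero_mul, Finset.sum_ite_eq, Finset.sum_ite_eq', Finset.sum_ite_irrel,
    Finset.sum_const_zero, Finset.mem_univ, if_true]

/-- The link product is the contraction with a trivial ancilla. -/
theorem link_eq_contract (μ : Op (B ⊕ A)) (ρ : Op A) :
    link μ ρ = relabel (Equiv.sumEmpty B Empty)
      (contract μ (relabel (Equiv.sumEmpty A Empty).symm ρ)) := by
  ext x y
  rw [link_apply, relabel_apply, contract_apply]
  rfl

/-- The marginal condition leaves only the diagonal of `ρ`, so the postselection probability is the
same for all states. -/
theorem trace_link {μ : Op (B ⊕ A)} (ρ : Op A) (h : ptraceLeft μ = (dim A)⁻¹ • (1 : Op A)) :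
    (link μ ρ).trace = (dim A)⁻¹ * ρ.trace := by
  have h' : ∀ a a', ∑ x, μ (Sum.elim x a) (Sum.elim x a') = if a = a' then (dim A)⁻¹ else 0 := by
    intro a a'
    have := congrFun (congrFun h a) a'
    simpa [ptraceLeft, Matrix.one_apply] using this
  simp only [Matrix.trace, Matrix.diag_apply, link_apply]
  rw [Finset.sum_comm, Finset.mul_sum]
  refine Finset.sum_congr rfl fun a _ => ?_
  rw [Finset.sum_comm]
  simp [← Finset.sum_mul, h']

theorem isStabilizerState_link {μ : Op (B ⊕ A)} {ρ : Op A} (hμ : IsStabilizerState (B ⊕ A) μ)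
    (hρ : IsStabilizerState A ρ) (h : ptraceLeft μ = (dim A)⁻¹ • (1 : Op A)) :
    IsStabilizerState B (dim A • link μ ρ) := by
  rw [isStabilizerState_iff] at hμ hρ ⊢
  constructor
  · rw [dim_eq_ofReal, link_eq_contract]
    exact stabilizerClosed_stabCone.smul _ _ (by positivity)
      (relabel_mem_stabCone _ (contract_mem_stabCone hμ.1 (relabel_mem_stabCone _ hρ.1)))
  · rw [Matrix.trace_smul, trace_link ρ h, hρ.2, smul_eq_mul, mul_one,
      mul_inv_cancel₀ dim_ne_zero]

theorem trace_relabel (e : A ≃ B) (M : Op A) : (relabel e M).trace = M.trace :=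
  Fintype.sum_equiv (e.arrowCongr (Equiv.refl (Fin 2))).symm _ _ fun _ => rfl

theorem isStabilizerState_pairOp {μ : Op (B ⊕ A)} {ρ : Op A}
    (hμ : IsStabilizerState (B ⊕ A) μ) (hρ : IsStabilizerState A ρ) :
    IsStabilizerState (B ⊕ (A ⊕ A)) (pairOp μ ρ) := by
  rw [isStabilizerState_iff] at hμ hρ ⊢
  exact ⟨relabel_mem_stabCone _ (tensor_mem_stabCone hμ.1 hρ.1), by
    rw [pairOp, trace_relabel, trace_tensor, hμ.2, hρ.2, mul_one]⟩

omit [Fintype B] [DecidableEq B] [Fintype R] [DecidableEq R] in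
theorem slice_apply (s : R → Fin 2) (M : Op (B ⊕ R)) (x y : B → Fin 2) :
    slice s M x y = M (Sum.elim x s) (Sum.elim y s) := rfl

theorem conjMap_apply (U M : Op A) : conjMap U M = U * M * Uᴴ := rfl

theorem outcomeProb_eq_trace_slice (ω : Op (B ⊕ R)) (s : R → Fin 2) :
    outcomeProb ω s = (slice s ω).trace := by
  simp only [outcomeProb, outcomeProj, Matrix.trace, Matrix.diag_apply, Matrix.mul_apply,
    sum_elim, tensor_elim, Matrix.one_apply, Matrix.single_apply]
  simp [ite_and, slice_apply]

theorem ptraceRight_outcomeProj (ω : Op (B ⊕ R)) (s : R → Fin 2) :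
    ptraceRight (outcomeProj B s * ω * outcomeProj B s) = slice s ω := by
  ext x y
  simp only [ptraceRight, outcomeProj, Matrix.of_apply, Matrix.mul_apply,
    sum_elim, tensor_elim, Matrix.one_apply, Matrix.single_apply]
  simp [ite_and, slice_apply]

/-- The Bell vector enters once as a bra and once as a ket, and the two amplitudes `2^(-n/2)`
multiply to `1 / d_A`. -/
theorem slice_bell_circuit {U : Op (A ⊕ A)} (hU : U ∈ cliffordCircuits (A ⊕ A))
    (e : U *ᵥ bellVector 0 = Pi.single 0 1) (μ : Op (B ⊕ A)) (ρ : Op A) :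
    slice 0 (conjMap (tensor (1 : Op B) U) (pairOp μ ρ)) = (dim A)⁻¹ • link μ ρ := by
  ext x y
  simp only [slice_apply, conjMap_apply, Matrix.mul_apply,
    Matrix.conjTranspose_apply, sum_elim, tensor_elim, star_mul', pairOp_elim, Matrix.one_apply,
    bell_circuit_zero_row hU e, bellVector_zero_elim, Matrix.smul_apply, link_apply]
  simp only [ite_mul, mul_ite, one_mul, zero_mul, mul_zero, Finset.sum_ite_eq,
    Finset.mem_univ, if_true, Finset.sum_ite_irrel, Finset.sum_const_zero, apply_ite star, star_one,
    star_zero]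
  rw [dim, ← sqrt_two_inv_pow_mul_self, smul_eq_mul, star_sqrt_two_inv_pow]
  simp only [Finset.mul_sum, Finset.sum_mul]
  rw [Finset.sum_comm]
  exact Finset.sum_congr rfl fun a _ => Finset.sum_congr rfl fun a' _ => by ring

end Choi

/-! ### The resource theory of magic states -/

section ResourceTheory

variable {A B : Type} [Fintype A] [DecidableEq A] [Fintype B] [DecidableEq B]

theorem relabelInvariant_isStabilizerState : RelabelInvariant IsStabilizerState := by
  intro A B _ _ _ _ e M hM
  rw [isStabilizerState_iff] at hM ⊢
  exact ⟨relabel_mem_stabCone e hM.1, by rw [trace_relabel, hM.2]⟩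

theorem cdOps_prepareMap {ρ : Op A} (hρ : IsStabilizerState A ρ) :
    CDOps IsStabilizerState Empty A (prepareMap ρ) :=
  cdOps_iff_crngOps.mpr <| crngOps_of_preserves
    (fun M => by simp [prepareMap, trace_of_isStabilizerState hρ])
    fun _ hQ => hQ.preserves_prepareMap hρ

/-- The trivial system has dimension one, so the renormalized Choi matrix of a preparation is the
prepared state itself, up to renaming. -/
theorem freeStates_cdOps_iff (ρ : Op A) :
    freeStates (CDOps IsStabilizerState) A ρ ↔ IsStabilizerState A ρ := by
  refine ⟨fun h => ?_, cdOps_prepareMap⟩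
  have h2 := relabelInvariant_isStabilizerState (Equiv.sumEmpty A Empty) _ h.2
  convert h2 using 1
  ext x y
  rw [relabel_apply, renormChoi_eq, tensorMap_id_apply]
  simp [block, prepareMap, Matrix.trace, dim, choiState, tensor, Matrix.single_apply]
  exact fun h => absurd (Subsingleton.elim _ _) (h (Subsingleton.elim _ _))

theorem cdOps_of_preserves {E : Op A →ₗ[ℂ] Op B} (htr : ∀ M, (E M).trace = M.trace)
    (h : ∀ Q : OpClass, RelabelInvariant Q → Preserves Q E) :
    CDOps IsStabilizerState A B E :=
  cdOps_iff_crngOps.mpr <| crngOps_of_preserves htr fun Q hQ => h Q hQ.relabel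

/-- Composition is opaque on Choi matrices but immediate for completely preserving maps, so each
closure clause passes through `cdOps_iff_crngOps`. -/
theorem isResourceTheory_cdOps : IsResourceTheory (CDOps IsStabilizerState) where
  channel _ _ _ _ _ _ _ h := h.1
  id_free A _ _ := cdOps_of_preserves (fun _ => rfl) fun _ hQ => preserves_id hQ
  swap_free A B _ _ _ _ := cdOps_of_preserves (trace_relabel _) fun _ hQ => preserves_relabel hQ _
  relabel_free A B _ _ _ _ e :=
    cdOps_of_preserves (trace_relabel e) fun _ hQ => preserves_relabel hQ e
  discard_free A _ _ := cdOps_iff_crngOps.mpr <| crngOps_of_preserves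
    (fun M => by simp [discard, Matrix.trace]) fun _ hQ => hQ.preserves_discard
  comp_free A B C _ _ _ _ _ _ E G hE hG := by
    rw [cdOps_iff_crngOps] at *
    exact ⟨⟨Preserves.comp (Q := fun _ _ _ M => M.PosSemidef) hG.1.1 hE.1.1,
      fun M => (hG.1.2 _).trans (hE.1.2 M)⟩, Preserves.comp hG.2 hE.2⟩
  tensor_free A B C D _ _ _ _ _ _ _ _ E G hE hG := by
    rw [cdOps_iff_crngOps] at *
    exact ⟨⟨preserves_tensorMap (Q := fun _ _ _ M => M.PosSemidef)
      stabilizerClosed_posSemidef.relabel hE.1.1 hG.1.1, trace_tensorMap _ _ hE.1.2 hG.1.2⟩,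
      preserves_tensorMap relabelInvariant_isStabilizerState hE.2 hG.2⟩

theorem isCDRT_cdOps : IsCDRT (CDOps IsStabilizerState) :=
  ⟨isResourceTheory_cdOps, fun _ _ _ _ _ _ _ => and_congr_right fun _ =>
    (freeStates_cdOps_iff _).symm⟩

/-! ### Stabilizer operations -/

theorem trace_branch_add (M : Op (Unit ⊕ A)) :
    (branch A 0 M).trace + (branch A 1 M).trace = M.trace := by
  simp only [Matrix.trace, Matrix.diag_apply, sum_elim]
  rw [← Fintype.sum_equiv (Equiv.funUnique Unit (Fin 2)).symm
    (fun b => ∑ x, M (Sum.elim (fun _ => b) x) (Sum.elim (fun _ => b) x)) _ fun _ => rfl,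
    Fin.sum_univ_two]
  rfl

/-- The instances are quantified after the derivation because `IsStabilizerOp` is not indexed by
them; where they matter, subsingleton elimination identifies them with those of the constructor. -/
theorem preserves_of_isStabilizerOp {A B : Type} {E : Op A →ₗ[ℂ] Op B} (h : IsStabilizerOp E) :
    ∀ [Fintype A] [DecidableEq A] [Fintype B] [DecidableEq B],
      (∀ M, (E M).trace = M.trace) ∧
        ∀ Q : OpClass, StabilizerClosed Q → Preserves Q E := by
  induction h with
  | relabel e =>
    intro _ _ _ _
    exact ⟨trace_relabel e, fun Q hQ => preserves_relabel hQ.relabel e⟩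
  | @clifford A i₁ i₂ U hU =>
    intro j₁ j₂ j₃ j₄
    obtain rfl : i₁ = j₁ := Subsingleton.elim _ _
    obtain rfl : i₂ = j₂ := Subsingleton.elim _ _
    obtain rfl : i₁ = j₃ := Subsingleton.elim _ _
    obtain rfl : i₂ = j₄ := Subsingleton.elim _ _
    exact ⟨trace_conj_of_clifford hU, fun Q hQ => hQ.preserves_conjMap hU⟩
  | prepare A =>
    intro _ _ j₃ j₄
    obtain rfl : instFintypeSum Unit A = j₃ := Subsingleton.elim _ _
    obtain rfl : instDecidableEqSum = j₄ := Subsingleton.elim _ _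
    refine ⟨fun M => ?_, fun Q hQ => hQ.preserves_attachZero⟩
    exact (trace_tensor _ M).trans (by rw [trace_zeroState, one_mul])
  | @measure A B _ _ _ _ E hE ih =>
    intro j₁ j₂ _ _
    obtain rfl : instFintypeSum Unit A = j₁ := Subsingleton.elim _ _
    obtain rfl : instDecidableEqSum = j₂ := Subsingleton.elim _ _
    rw [Fin.sum_univ_two]
    refine ⟨fun M => ?_, fun Q hQ => hQ.preserves_add
      (((ih 0).2 Q hQ).comp (hQ.preserves_branch 0)) (((ih 1).2 Q hQ).comp (hQ.preserves_branch 1))⟩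
    simp only [LinearMap.add_apply, LinearMap.comp_apply, Matrix.trace_add, (ih _).1,
      trace_branch_add]
  | comp E F hE hF ihE ihF =>
    intro _ _ _ _
    exact ⟨fun M => (ihF.1 _).trans (ihE.1 M), fun Q hQ => (ihF.2 Q hQ).comp (ihE.2 Q hQ)⟩
  | mix p hp0 hp1 E F hE hF ihE ihF =>
    intro _ _ _ _
    refine ⟨fun M => ?_, fun Q hQ => hQ.preserves_add (hQ.preserves_smul hp0 (ihE.2 Q hQ))
      (hQ.preserves_smul (sub_nonneg.mpr hp1) (ihF.2 Q hQ))⟩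
    simp [ihE.1, ihF.1, ← add_mul]

theorem cdOps_of_isStabilizerOp {E : Op A →ₗ[ℂ] Op B} (h : IsStabilizerOp E) :
    CDOps IsStabilizerState A B E :=
  have h := preserves_of_isStabilizerOp h
  cdOps_iff_crngOps.mpr <| crngOps_of_preserves h.1 h.2

omit [Fintype A] [DecidableEq A] [Fintype B] [DecidableEq B] in
theorem comp_prepareMap (E : Op A →ₗ[ℂ] Op B) (ρ : Op A) :
    E ∘ₗ prepareMap ρ = prepareMap (E ρ) :=
  LinearMap.ext fun _ => map_smul E _ _

theorem isStabilizerOp_prepareMap_relabel (e : A ≃ B) {ρ : Op A}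
    (h : IsStabilizerOp (prepareMap ρ)) : IsStabilizerOp (prepareMap (relabel e ρ)) := by
  rw [← comp_prepareMap]
  exact .comp _ _ h (.relabel e)

omit [DecidableEq A] [DecidableEq B] in
theorem relabel_zeroState (e : A ≃ B) : relabel e (zeroState A) = zeroState B := by
  ext x y
  have : ∀ x : B → Fin 2, 0 = (fun a => x (e a)) ↔ 0 = x := by
    intro x
    simp only [funext_iff, e.forall_congr_left, Pi.zero_apply, Equiv.apply_symm_apply]
  simp only [relabel_apply, zeroState, Matrix.single_apply, this]

/-- Qubits are attached one at a time along `Fin n`; the base case is the identity of the trivial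
system, a renaming. -/
theorem isStabilizerOp_prepareMap_zeroState (A : Type) [Fintype A] [DecidableEq A] :
    IsStabilizerOp (prepareMap (zeroState A)) := by
  have key : ∀ n : ℕ, IsStabilizerOp (prepareMap (zeroState (Fin n))) := by
    intro n
    induction n with
    | zero =>
      have h : IsStabilizerOp (prepareMap (zeroState Empty)) := by
        convert IsStabilizerOp.relabel (Equiv.refl Empty) using 1
        refine LinearMap.ext fun M => Matrix.ext fun x y => ?_
        obtain rfl : x = 0 := Subsingleton.elim _ _
        obtain rfl : y = 0 := Subsingleton.elim _ _
        rw [relabel_refl]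
        simp [prepareMap, Matrix.trace, zeroState]
        congr 1 <;> exact Subsingleton.elim _ _
      convert isStabilizerOp_prepareMap_relabel (Equiv.equivOfIsEmpty Empty (Fin 0)) h
      rw [relabel_zeroState]
    | succ n ih =>
      have h := IsStabilizerOp.comp _ _ ih (.prepare (Fin n))
      rw [comp_prepareMap] at h
      have h0 : attachZero (Fin n) (zeroState (Fin n)) = zeroState (Unit ⊕ Fin n) := by
        refine op_ext_elim fun x y x' y' => ?_
        have h : ∀ (x : Unit → Fin 2) (y : Fin n → Fin 2),
            0 = Sum.elim x y ↔ 0 = x ∧ 0 = y := by simp [funext_iff]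
        change zeroState Unit x x' * zeroState (Fin n) y y' = _
        simp only [zeroState, Matrix.single_apply, h]
        split_ifs <;> first | (exfalso; tauto) | simp
      rw [h0] at h
      have e : Unit ⊕ Fin n ≃ Fin (n + 1) := Fintype.equivFinOfCardEq (by simp [add_comm])
      rw [← relabel_zeroState e]
      exact isStabilizerOp_prepareMap_relabel e h
  rw [← relabel_zeroState (Fintype.equivFin A).symm]
  exact isStabilizerOp_prepareMap_relabel _ (key _)

theorem isStabilizerOp_prepareMap_iff (ρ : Op A) :
    IsStabilizerOp (prepareMap ρ) ↔ IsStabilizerState A ρ := by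
  refine ⟨fun h => (freeStates_cdOps_iff ρ).mp (cdOps_of_isStabilizerOp h), fun h => ?_⟩
  -- Probabilistic mixing makes the preparable states convex, so only the pure states `U|0…0⟩`
  -- remain.
  have hc : Convex ℝ {ρ : Op A | IsStabilizerOp (prepareMap ρ)} := by
    intro σ hσ τ hτ a b ha hb hab
    obtain rfl : b = 1 - a := by linarith
    have e : prepareMap (a • σ + (1 - a) • τ) =
        (a : ℂ) • prepareMap σ + ((1 - a : ℝ) : ℂ) • prepareMap τ := by
      refine LinearMap.ext fun M => ?_
      simp only [prepareMap, LinearMap.coe_mk, AddHom.coe_mk, LinearMap.add_apply,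
        LinearMap.smul_apply, smul_add, Complex.coe_smul]
      rw [smul_comm a M.trace σ, smul_comm (1 - a) M.trace τ]
    change IsStabilizerOp (prepareMap (a • σ + (1 - a) • τ))
    rw [e]
    exact .mix a ha (by linarith) _ _ hσ hτ
  refine convexHull_min ?_ hc h
  rintro _ ⟨U, hU, rfl⟩
  have := IsStabilizerOp.comp _ _ (isStabilizerOp_prepareMap_zeroState A) (.clifford U hU)
  rwa [comp_prepareMap] at this

end ResourceTheory

end MagicCDRT

/-! ### The main theorem -/

theorem mainTheorem10 :
    -- the renormalized Choi state is a stabilizer state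
    (∀ (A : Type) [Fintype A] [DecidableEq A],
      IsStabilizerState (A ⊕ A) ((dim A)⁻¹ • choiState A)) ∧
    -- closure under the link product with free renormalized Choi matrices
    (∀ (A B : Type) [Fintype A] [DecidableEq A] [Fintype B] [DecidableEq B]
      (μ : Op (B ⊕ A)) (ρ : Op A), IsStabilizerState (B ⊕ A) μ → IsStabilizerState A ρ →
      ptraceLeft μ = (dim A)⁻¹ • (1 : Op A) →
      IsStabilizerState B (dim A • link μ ρ)) ∧
    -- the postselected Bell-measurement protocol that realizes the link product
    (∀ (A : Type) [Fintype A] [DecidableEq A],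
      Matrix.vecMulVec (bellVector (0 : A ⊕ A → Fin 2)) (star (bellVector 0)) =
        (dim A)⁻¹ • choiState A ∧
      ∃ U ∈ hadamardCnotCircuits (A ⊕ A),
        (∀ s : A ⊕ A → Fin 2, U *ᵥ bellVector s = Pi.single s 1) ∧
        ∀ (B : Type) [Fintype B] [DecidableEq B] (μ : Op (B ⊕ A)) (ρ : Op A),
          IsStabilizerState (B ⊕ A) μ → IsStabilizerState A ρ →
          ptraceLeft μ = (dim A)⁻¹ • (1 : Op A) →
          tensor (1 : Op B) U ∈ cliffordCircuits (B ⊕ (A ⊕ A)) ∧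
          IsStabilizerState (B ⊕ (A ⊕ A)) (pairOp μ ρ) ∧
          outcomeProb (conjMap (tensor (1 : Op B) U) (pairOp μ ρ)) 0 = (dim A ^ 2)⁻¹ ∧
          postselect (conjMap (tensor (1 : Op B) U) (pairOp μ ρ)) 0 = dim A • link μ ρ) ∧
    -- the Choi-defined operations of the stabilizer states form a CDRT with these free states
    IsCDRT (CDOps IsStabilizerState) ∧
    (∀ (A : Type) [Fintype A] [DecidableEq A] (ρ : Op A),
      freeStates (CDOps IsStabilizerState) A ρ ↔ IsStabilizerState A ρ) ∧
    -- its free operations are the completely stabilizer-preserving channels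
    (∀ (A B : Type) [Fintype A] [DecidableEq A] [Fintype B] [DecidableEq B]
      (E : Op A →ₗ[ℂ] Op B),
      CDOps IsStabilizerState A B E ↔ CRNGOps IsStabilizerState A B E) ∧
    -- every stabilizer operation is free, and the states prepared by stabilizer operations are
    -- exactly the stabilizer states
    (∀ (A B : Type) [Fintype A] [DecidableEq A] [Fintype B] [DecidableEq B]
      (E : Op A →ₗ[ℂ] Op B), IsStabilizerOp E → CDOps IsStabilizerState A B E) ∧
    (∀ (A : Type) [Fintype A] [DecidableEq A] (ρ : Op A),
      IsStabilizerOp (prepareMap ρ) ↔ IsStabilizerState A ρ) := by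
  refine ⟨fun A _ _ => isStabilizerState_choiState,
    fun A B _ _ _ _ μ ρ hμ hρ h => isStabilizerState_link hμ hρ h,
    fun A _ _ => ⟨pureOp_bellVector_zero, ?_⟩, isCDRT_cdOps,
    fun A _ _ ρ => freeStates_cdOps_iff ρ, fun A B _ _ _ _ E => cdOps_iff_crngOps,
    fun A B _ _ _ _ E h => cdOps_of_isStabilizerOp h,
    fun A _ _ ρ => isStabilizerOp_prepareMap_iff ρ⟩
  obtain ⟨U, hU, e⟩ := exists_bell_circuit A
  have hU' := hadamardCnotCircuits_le hU
  refine ⟨U, hU, e, fun B _ _ μ ρ hμ hρ h => ?_⟩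
  -- One factor `1 / d_A` comes from the Bell projection, the other from the trace of the link
  -- product; normalizing by their product turns the first into `d_A`.
  have hprob : outcomeProb (conjMap (tensor (1 : Op B) U) (pairOp μ ρ)) 0 = (dim A ^ 2)⁻¹ := by
    rw [outcomeProb_eq_trace_slice, slice_bell_circuit hU' (e 0), Matrix.trace_smul,
      trace_link ρ h, trace_of_isStabilizerState hρ, mul_one, smul_eq_mul, ← mul_inv, pow_two]
  refine ⟨tensor_one_mem_cliffordCircuits hU', isStabilizerState_pairOp hμ hρ, hprob, ?_⟩
  rw [postselect, hprob, inv_inv, ptraceRight_outcomeProj, slice_bell_circuit hU' (e 0),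
    smul_smul, pow_two, mul_inv_cancel_right₀ dim_ne_zero]
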